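/- Let $\mathbb T^n=\mathbb R^n/\mathbb Z^n$ and let $H:\mathbb T^n\times\mathbb R^n\to\mathbb R$ satisfy: $(\mathcal H_1)$ $H\in C^2(\mathbb T^n\times\mathbb R^n)$, $\inf_{x\in\mathbb T^n}H(x,\xi)/|\xi|\to+\infty$ as $|\xi|\to\infty$, and $D_{\xi\xi}H(x,\xi)$ is positive definite for all $(x,\xi)$; $(\mathcal H_2)$ $\lim_{|\xi|\to\infty}\inf_{x\in\mathbb T^n}\left(\tfrac12 H(x,\xi)^2+D_xH(x,\xi)\cdot\xi\right)=+\infty$. Then for each $p\in\mathbb R^n$ there is a unique constant $\overline H(p)\in\mathbb R$ for which the cell problem $H(x,p+Du(x))=\overline H(p)$ on $\mathbb T^n$ has a viscosity solution $u\in C(\mathbb T^n)$. Let $L(x,v)=\sup_{\xi\in\mathbb R^n}(\xi\cdot v-H(x,\xi))$. Let $\mathcal C(0)$ be the set of Borel probability measures $\mu$ on $\mathbb T^n\times\mathbb R^n$ with $\int|v|\,d\mu<\infty$ and $\int v\cdot D\varphi(x)\,d\mu(x,v)=0$ for all $\varphi\in C^2(\mathbb T^n)$, and let $\mathcal M_p(0)$,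 the set of Mather measures, be the set of those $\mu\in\mathcal C(0)$ that minimize $\int (L(x,v)-p\cdot v)\,d\mu(x,v)$ over $\mathcal C(0)$. For every $p\in\mathbb R^n$ and every direction $\xi\in\mathbb R^n$ the one-sided directional derivatives $D_{\xi\pm}\overline H(p)=\lim_{t\to0^\pm}\frac{\overline H(p+t\xi)-\overline H(p)}{t}$ exist, and $$D_{\xi+}\overline H(p)=\max_{\mu\in\mathcal M_p(0)}\int_{\mathbb T^n\times\mathbb R^n}v\cdot\xi\,d\mu(x,v),\qquad D_{\xi-}\overline H(p)=\min_{\mu\in\mathcal M_p(0)}\int_{\mathbb T^n\times\mathbb R^n}v\cdot\xi\,d\mu(x,v).$$ The maximum and the minimum are attained. In particular, if $\mathcal M_p(0)=\{\mu\}$ is a singleton, then $\overline H$ is differentiable at $p$ and $D\overline H(p)=\int_{\mathbb T^n\times\mathbb R^n}v\,d\mu(x,v)$. -/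

import Mathlib

open MeasureTheory Filter Topology

noncomputable section

/-- Euclidean space `ℝⁿ`. -/
abbrev Rn (n : ℕ) : Type := EuclideanSpace ℝ (Fin n)

/-- The flat torus `𝕋ⁿ = ℝⁿ / ℤⁿ`. -/
abbrev Tn (n : ℕ) : Type := UnitAddTorus (Fin n)

/-- The quotient map `ℝⁿ → 𝕋ⁿ`. -/
def torusProj {n : ℕ} (x : Rn n) : Tn n := fun i => (x i : UnitAddCircle)

/-- The representative in `[0,1)ⁿ` of a point of the torus. -/
def torusLift {n : ℕ} (x : Tn n) : Rn n :=
  WithLp.toLp 2 fun i => (AddCircle.equivIco (1 : ℝ) 0 (x i) : ℝ)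

theorem torusProj_torusLift {n : ℕ} (x : Tn n) : torusProj (torusLift x) = x := by
  funext i
  exact (AddCircle.equivIco (1 : ℝ) 0).symm_apply_apply (x i)

/-- `f : 𝕋ⁿ → ℝ` is of class `C^k`: its `ℤⁿ`-periodic lift to `ℝⁿ` is. -/
def TorusContDiff {n : ℕ} (k : ℕ) (f : Tn n → ℝ) : Prop :=
  ContDiff ℝ k fun y : Rn n => f (torusProj y)

/-- The gradient `Df(x)` of `f : 𝕋ⁿ → ℝ` at `x`: the gradient of the periodic lift at a
representative of `x`. It does not depend on the representative, see `torusGrad_torusProj`. -/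
def torusGrad {n : ℕ} (f : Tn n → ℝ) (x : Tn n) : Rn n :=
  gradient (fun y : Rn n => f (torusProj y)) (torusLift x)

theorem torusGrad_torusProj {n : ℕ} (f : Tn n → ℝ) (y : Rn n) :
    torusGrad f (torusProj y) = gradient (fun z : Rn n => f (torusProj z)) y := by
  have hadd : ∀ a b : Rn n, torusProj (a + b) = torusProj a + torusProj b := by
    intro a b
    funext i
    simp [torusProj]
  set a : Rn n := torusLift (torusProj y) - y with ha
  have hy : torusLift (torusProj y) = y + a := by simp [ha]
  have h0 : torusProj a = 0 := by
    have h1 := torusProj_torusLift (torusProj y)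
    rw [hy, hadd] at h1
    simpa using h1
  have hper : (fun z : Rn n => f (torusProj (z + a))) = fun z => f (torusProj z) := by
    funext z
    rw [hadd, h0, add_zero]
  have h2 := fderiv_comp_add_right (𝕜 := ℝ) (f := fun z : Rn n => f (torusProj z)) (x := y) a
  rw [hper] at h2
  unfold torusGrad gradient
  rw [hy, ← h2]

/-- Assumption (H₁), "Tonelli": `H ∈ C²(𝕋ⁿ × ℝⁿ)`, `H` is superlinear in `ξ` uniformly in `x`,
and `D_ξξ H(x,ξ)` is positive definite. -/
structure AssumptionH1 {n : ℕ} (H : Tn n → Rn n → ℝ) : Prop where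
  contDiff : ContDiff ℝ 2 fun z : Rn n × Rn n => H (torusProj z.1) z.2
  superlinear : Tendsto (fun ξ : Rn n => ⨅ x : Tn n, H x ξ / ‖ξ‖) (Bornology.cobounded (Rn n)) atTop
  posDef : ∀ (x : Tn n) (ξ η : Rn n), η ≠ 0 → 0 < fderiv ℝ (fderiv ℝ (H x)) ξ η η

/-- Assumption (H₂): `inf_x (½ H(x,ξ)² + D_x H(x,ξ) · ξ) → +∞` as `|ξ| → ∞`. -/
def AssumptionH2 {n : ℕ} (H : Tn n → Rn n → ℝ) : Prop :=
  Tendsto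
    (fun ξ : Rn n => ⨅ x : Tn n, (1 / 2 * H x ξ ^ 2 + inner ℝ (torusGrad (fun y => H y ξ) x) ξ))
    (Bornology.cobounded (Rn n)) atTop

/-- The Lagrangian `L(x,v) = sup_ξ (ξ · v - H(x,ξ))`. -/
def lagrangian {n : ℕ} (H : Tn n → Rn n → ℝ) (x : Tn n) (v : Rn n) : ℝ :=
  ⨆ ξ : Rn n, (inner ℝ ξ v - H x ξ)

/-- `u ∈ C(𝕋ⁿ)` is a viscosity solution of `H(x, p + Du(x)) = c` on `𝕋ⁿ`. Points, and the `C¹`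
functions touching from above and from below, are taken in the cover `ℝⁿ` of the torus. -/
structure IsViscositySolution {n : ℕ} (H : Tn n → Rn n → ℝ) (p : Rn n) (c : ℝ)
    (u : Tn n → ℝ) : Prop where
  continuous : Continuous u
  subsolution : ∀ (φ : Rn n → ℝ) (y : Rn n), ContDiff ℝ 1 φ →
    IsLocalMax (fun z => u (torusProj z) - φ z) y → H (torusProj y) (p + gradient φ y) ≤ c
  supersolution : ∀ (φ : Rn n → ℝ) (y : Rn n), ContDiff ℝ 1 φ →
    IsLocalMin (fun z => u (torusProj z) - φ z) y → c ≤ H (torusProj y) (p + gradient φ y)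

/-- The cell problem `H(x, p + Du(x)) = c` has a continuous viscosity solution on the torus. -/
def CellProblemSolvable {n : ℕ} (H : Tn n → Rn n → ℝ) (p : Rn n) (c : ℝ) : Prop :=
  ∃ u : Tn n → ℝ, IsViscositySolution H p c u

/-- The effective Hamiltonian `H̄(p)`: the constant `c` for which the cell problem is solvable. -/
def effectiveHamiltonian {n : ℕ} (H : Tn n → Rn n → ℝ) (p : Rn n) : ℝ :=
  Classical.epsilon fun c : ℝ => CellProblemSolvable H p c

/-- Holonomic measures (for `ε = 0`): Borel probability measures on `𝕋ⁿ × ℝⁿ` with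
`∫ |v| dμ < ∞` and `∫ v · Dφ(x) dμ = 0` for all `φ ∈ C²(𝕋ⁿ)`. -/
structure IsHolonomic {n : ℕ} (μ : Measure (Tn n × Rn n)) : Prop where
  isProbabilityMeasure : IsProbabilityMeasure μ
  integrable_norm : Integrable (fun z : Tn n × Rn n => ‖z.2‖) μ
  integral_eq_zero : ∀ φ : Tn n → ℝ, TorusContDiff 2 φ →
    ∫ z : Tn n × Rn n, inner ℝ z.2 (torusGrad φ z.1) ∂μ = 0

/-- The action density `L(x,v) - p · v`. -/
def actionDensity {n : ℕ} (H : Tn n → Rn n → ℝ) (p : Rn n) (z : Tn n × Rn n) : ℝ :=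
  lagrangian H z.1 z.2 - inner ℝ p z.2

/-- The set `M_p(0)` of Mather measures: the holonomic measures that minimize `∫ (L - p · v) dμ`
among all holonomic measures. The integrand is continuous and bounded below, so an integral that
does not exist as a finite number is `+∞`; such measures are neither minimizers nor competitors. -/
def matherMeasures {n : ℕ} (H : Tn n → Rn n → ℝ) (p : Rn n) : Set (Measure (Tn n × Rn n)) :=
  {μ | IsHolonomic μ ∧ Integrable (actionDensity H p) μ ∧
    ∀ ν : Measure (Tn n × Rn n), IsHolonomic ν → Integrable (actionDensity H p) ν →
      ∫ z, actionDensity H p z ∂μ ≤ ∫ z, actionDensity H p z ∂ν}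

end

/-!
The effective Hamiltonian is identified with a minimax value, and this value is then differentiated
with respect to `p` by linear duality; no trajectories are used.

*The cell problem.* Perron's method solves the discounted equation `lam U + H(y, p + DU) = 0` on the
cover `ℝⁿ` (`exists_discounted_solution`). Coercivity makes the solutions Lipschitz uniformly in
`lam`, so that, normalized at a point, they converge along an ultrafilter as `lam → 0` to a solution
of the cell problem (`exists_ergodic_solution`). A constant `c` for which the cell problem is
solvable is always the infimum of the levels `a` such that `H(x, p + Dφ) ≤ a` for some `φ` of class
`C²` (`AssumptionH1.isGLB_of_cellProblemSolvable`): such a `φ` can be used as a test function for the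
supersolution, and conversely a viscosity subsolution is Lipschitz, hence a subsolution almost
everywhere by Rademacher's theorem, and mollification gives smooth subsolutions at levels close
to `c` because `H` is convex in the momentum. So `c` is unique, and it is a convex function of `p`.

*Duality.* Integrating `L(x, v) - p · v ≥ v · Dφ - H(x, p + Dφ)` against a holonomic measure shows that
its action is at least `-H̄(p)` (`AssumptionH1.neg_effectiveHamiltonian_le`). Hence the mean of `v`
under a Mather measure at `p` is a subgradient of `H̄` at `p`. Conversely, if `d` is a supporting slope
of `t ↦ H̄(p + t ξ)` at `0`, there is a Mather measure under which `v · ξ` has mean `d`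
(`AssumptionH1.exists_holonomic`). It comes from the M. Riesz extension theorem and the
Riesz-Markov-Kakutani theorem on a compact set of positions and momenta, in the coordinates
`v = D_ξ H(x, P)`, in which `L` is the explicit continuous function `P · v - H(x, P)`. The positivity
needed for the extension is the minimax formula for `H̄` (`AssumptionH1.exists_radius_nonneg`).

The right derivative of the convex function `t ↦ H̄(p + t ξ)` at `0` is a supporting slope, so it is the
mean of `v · ξ` for some Mather measure, and no Mather measure has a larger mean. Reversing `ξ` gives
the left derivative. If there is only one Mather measure, the partial derivatives of `H̄` exist at `p`,
and for a convex function with a supporting hyperplane this implies differentiability.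
-/

/-! ### The torus and its universal cover -/

theorem torusProj_add {n : ℕ} (a b : Rn n) : torusProj (a + b) = torusProj a + torusProj b := by
  funext i
  simp [torusProj]

theorem torusProj_zero {n : ℕ} : torusProj (0 : Rn n) = 0 := by
  funext i
  simp [torusProj]

theorem torusProj_sub {n : ℕ} (a b : Rn n) : torusProj (a - b) = torusProj a - torusProj b := by
  funext i
  simp [torusProj]

theorem isOpenQuotientMap_torusProj {n : ℕ} : IsOpenQuotientMap (torusProj : Rn n → Tn n) := by
  have h : IsOpenQuotientMap
      (Pi.map (fun (_ : Fin n) (t : ℝ) => (t : UnitAddCircle))) :=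
    IsOpenQuotientMap.piMap fun _ => QuotientAddGroup.isOpenQuotientMap_mk
  exact h.comp (EuclideanSpace.equiv (Fin n) ℝ).toHomeomorph.isOpenQuotientMap

theorem continuous_torusProj {n : ℕ} : Continuous (torusProj : Rn n → Tn n) :=
  isOpenQuotientMap_torusProj.continuous

theorem continuous_comp_torusProj_iff {n : ℕ} {X : Type*} [TopologicalSpace X] {f : Tn n → X} :
    Continuous (fun y : Rn n => f (torusProj y)) ↔ Continuous f :=
  isOpenQuotientMap_torusProj.isQuotientMap.continuous_iff.symm

theorem continuous_comp_torusProj_prod_iff {n : ℕ} {X Y : Type*} [TopologicalSpace X]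
    [TopologicalSpace Y] {f : Tn n × X → Y} :
    Continuous (fun z : Rn n × X => f (torusProj z.1, z.2)) ↔ Continuous f :=
  (isOpenQuotientMap_torusProj.prodMap
    (IsOpenQuotientMap.id (X := X))).isQuotientMap.continuous_iff.symm

theorem surjective_torusProj {n : ℕ} : Function.Surjective (torusProj : Rn n → Tn n) :=
  fun x => ⟨torusLift x, torusProj_torusLift x⟩

/-- A function on `ℝⁿ` that is invariant under the deck transformations of the torus descends. -/
theorem comp_torusLift_torusProj {n : ℕ} {X : Type*} {U : Rn n → X}
    (hU : ∀ a : Rn n, torusProj a = 0 → ∀ z, U (z + a) = U z) (z : Rn n) :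
    U (torusLift (torusProj z)) = U z := by
  have h : torusProj (torusLift (torusProj z) - z) = 0 := by
    rw [torusProj_sub, torusProj_torusLift, sub_self]
  have := hU _ h z
  rwa [add_sub_cancel] at this

theorem TorusContDiff.continuous_torusGrad {n : ℕ} {k : ℕ} {φ : Tn n → ℝ}
    (h : TorusContDiff k φ) (hk : 1 ≤ k) : Continuous (torusGrad φ) := by
  rw [← continuous_comp_torusProj_iff]
  simp only [torusGrad_torusProj]
  have h1 : Continuous (fderiv ℝ (fun y : Rn n => φ (torusProj y))) :=
    ContDiff.continuous_fderiv h (by exact_mod_cast (by omega : k ≠ 0))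
  exact (InnerProductSpace.toDual ℝ (Rn n)).symm.continuous.comp h1

theorem TorusContDiff.differentiable {n : ℕ} {k : ℕ} {φ : Tn n → ℝ}
    (h : TorusContDiff k φ) (hk : 1 ≤ k) : Differentiable ℝ fun y : Rn n => φ (torusProj y) :=
  ContDiff.differentiable h (by exact_mod_cast (by omega : k ≠ 0))

theorem TorusContDiff.linear_combination {n : ℕ} {k : ℕ} {φ ψ : Tn n → ℝ}
    (hφ : TorusContDiff k φ) (hψ : TorusContDiff k ψ) (a b : ℝ) :
    TorusContDiff k fun x => a * φ x + b * ψ x :=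
  (contDiff_const.mul hφ).add (contDiff_const.mul hψ)

theorem torusGrad_linear_combination {n : ℕ} {k : ℕ} {φ ψ : Tn n → ℝ} (hk : 1 ≤ k)
    (hφ : TorusContDiff k φ) (hψ : TorusContDiff k ψ) (a b : ℝ) (x : Tn n) :
    torusGrad (fun x => a * φ x + b * ψ x) x = a • torusGrad φ x + b • torusGrad ψ x := by
  unfold torusGrad gradient
  have h1 := hφ.differentiable hk (torusLift x)
  have h2 := hψ.differentiable hk (torusLift x)
  rw [fderiv_fun_add (h1.const_mul a) (h2.const_mul b), fderiv_const_mul h1, fderiv_const_mul h2]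
  simp

theorem torusContDiff_const {n : ℕ} (k : ℕ) (c : ℝ) : TorusContDiff k fun _ : Tn n => c :=
  contDiff_const

theorem torusGrad_const {n : ℕ} (c : ℝ) (x : Tn n) : torusGrad (fun _ : Tn n => c) x = 0 := by
  simp [torusGrad]

/-! ### Tonelli Hamiltonians -/

namespace AssumptionH1

variable {n : ℕ} {H : Tn n → Rn n → ℝ}

theorem continuous (h1 : AssumptionH1 H) : Continuous fun z : Tn n × Rn n => H z.1 z.2 :=
  continuous_comp_torusProj_prod_iff.1 h1.contDiff.continuous

theorem contDiff_fiber (h1 : AssumptionH1 H) (x : Tn n) : ContDiff ℝ 2 (H x) := by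
  obtain ⟨y, rfl⟩ := surjective_torusProj x
  exact h1.contDiff.comp (contDiff_const.prodMk contDiff_id)

theorem differentiable_fiber (h1 : AssumptionH1 H) (x : Tn n) : Differentiable ℝ (H x) :=
  (h1.contDiff_fiber x).differentiable (by norm_num)

theorem continuous_gradient (h1 : AssumptionH1 H) :
    Continuous fun z : Tn n × Rn n => gradient (H z.1) z.2 := by
  rw [← continuous_comp_torusProj_prod_iff]
  have hF : Differentiable ℝ fun z : Rn n × Rn n => H (torusProj z.1) z.2 :=
    h1.contDiff.differentiable (by norm_num)
  have key : ∀ z : Rn n × Rn n, fderiv ℝ (H (torusProj z.1)) z.2 =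
      (fderiv ℝ (fun z : Rn n × Rn n => H (torusProj z.1) z.2) z).comp
        (ContinuousLinearMap.inr ℝ (Rn n) (Rn n)) := fun z => by
    have h := HasFDerivAt.comp (f := fun ξ : Rn n => (z.1, ξ)) z.2 (hF z).hasFDerivAt
      (hasFDerivAt_prodMk_right z.1 z.2)
    exact h.fderiv
  have h2 : Continuous fun z : Rn n × Rn n => fderiv ℝ (H (torusProj z.1)) z.2 := by
    simp only [key]
    exact (h1.contDiff.continuous_fderiv (by norm_num)).clm_comp continuous_const
  exact (InnerProductSpace.toDual ℝ (Rn n)).symm.continuous.comp h2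

theorem convexOn_line (h1 : AssumptionH1 H) (x : Tn n) (a e : Rn n) :
    ConvexOn ℝ Set.univ (fun t : ℝ => H x (a + t • e)) ∧
      ∀ t : ℝ, HasDerivAt (fun t : ℝ => H x (a + t • e)) (fderiv ℝ (H x) (a + t • e) e) t := by
  have hl : ∀ t : ℝ, HasDerivAt (fun t : ℝ => a + t • e) e t := fun t => by
    simpa using ((hasDerivAt_id t).smul_const e).const_add a
  have hd : ∀ t : ℝ, HasDerivAt (fun t : ℝ => H x (a + t • e))
      (fderiv ℝ (H x) (a + t • e) e) t := fun t =>
    (h1.differentiable_fiber x _).hasFDerivAt.comp_hasDerivAt t (hl t)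
  have hd2 : ∀ t : ℝ, HasDerivAt (fun t : ℝ => fderiv ℝ (H x) (a + t • e) e)
      (fderiv ℝ (fderiv ℝ (H x)) (a + t • e) e e) t := fun t => by
    have h3 : Differentiable ℝ (fderiv ℝ (H x)) :=
      ((h1.contDiff_fiber x).fderiv_right (m := 1) (by norm_num)).differentiable (by norm_num)
    have := (h3 _).hasFDerivAt.comp_hasDerivAt t (hl t)
    simpa using this.clm_apply (hasDerivAt_const t e)
  refine ⟨?_, hd⟩
  have e1 : deriv (fun t : ℝ => H x (a + t • e)) = fun t => fderiv ℝ (H x) (a + t • e) e :=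
    funext fun t => (hd t).deriv
  apply convexOn_univ_of_deriv2_nonneg (fun t => (hd t).differentiableAt)
  · rw [e1]
    exact fun t => (hd2 t).differentiableAt
  · intro t
    simp only [Function.iterate_succ, Function.iterate_zero, Function.comp, id]
    rw [e1, (hd2 t).deriv]
    rcases eq_or_ne e 0 with rfl | he
    · simp
    · exact (h1.posDef x _ e he).le

theorem convexOn (h1 : AssumptionH1 H) (x : Tn n) : ConvexOn ℝ Set.univ (H x) := by
  refine ⟨convex_univ, fun a _ b _ s t hs ht hst => ?_⟩
  have h := (h1.convexOn_line x a (b - a)).1.2 (Set.mem_univ 0) (Set.mem_univ 1) hs ht hst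
  have e : a + t • (b - a) = s • a + t • b := by
    rw [show s = 1 - t by linarith]; module
  simpa [e] using h

/-- The tangent hyperplanes of `H x` lie below its graph. -/
theorem add_inner_gradient_le (h1 : AssumptionH1 H) (x : Tn n) (a b : Rn n) :
    H x a + inner ℝ (gradient (H x) a) (b - a) ≤ H x b := by
  obtain ⟨hc, hd⟩ := h1.convexOn_line x a (b - a)
  have h := hc.le_slope_of_hasDerivAt (Set.mem_univ 0) (Set.mem_univ 1) zero_lt_one (hd 0)
  rw [slope_def_field] at h
  rw [inner_gradient_left]
  simp only [zero_smul, add_zero, one_smul, add_sub_cancel, sub_zero, div_one] at h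
  linarith

/-- Superlinearity, in the form of affine lower bounds of arbitrary slope. -/
theorem exists_mul_norm_sub_le (h1 : AssumptionH1 H) (A : ℝ) :
    ∃ B : ℝ, ∀ x ξ, A * ‖ξ‖ - B ≤ H x ξ := by
  have hbdd : ∀ ξ : Rn n, BddBelow (Set.range fun x : Tn n => H x ξ / ‖ξ‖) := fun ξ =>
    (isCompact_range ((h1.continuous.comp
      (continuous_id.prodMk continuous_const)).div_const _)).bddBelow
  have hev := h1.superlinear.eventually (eventually_ge_atTop A)
  obtain ⟨R, -, hR⟩ := (Metric.hasBasis_cobounded_compl_closedBall (0 : Rn n)).eventually_iff.1 hev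
  have hK : IsCompact ((Set.univ : Set (Tn n)) ×ˢ Metric.closedBall (0 : Rn n) (max R 0)) :=
    isCompact_univ.prod (isCompact_closedBall _ _)
  obtain ⟨B, hB⟩ := (hK.image (f := fun z : Tn n × Rn n => A * ‖z.2‖ - H z.1 z.2)
    (((continuous_const.mul continuous_snd.norm).sub h1.continuous))).bddAbove
  refine ⟨max B 0, fun x ξ => ?_⟩
  by_cases hξ : ξ ∈ Metric.closedBall (0 : Rn n) (max R 0)
  · have := hB ⟨(x, ξ), ⟨Set.mem_univ _, hξ⟩, rfl⟩
    simp only at this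
    linarith [le_max_left B 0]
  · rw [mem_closedBall_zero_iff, not_le, max_lt_iff] at hξ
    have hx : A ≤ ⨅ x : Tn n, H x ξ / ‖ξ‖ := hR (by simpa using hξ.1)
    have h2 := hx.trans (ciInf_le (hbdd ξ) x)
    rw [le_div_iff₀ hξ.2] at h2
    linarith [le_max_right B 0]

theorem exists_norm_le_of_le (h1 : AssumptionH1 H) (C : ℝ) :
    ∃ M : ℝ, 0 < M ∧ ∀ x ξ, H x ξ ≤ C → ‖ξ‖ ≤ M := by
  obtain ⟨B, hB⟩ := h1.exists_mul_norm_sub_le 1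
  exact ⟨max (C + B) 1, by positivity, fun x ξ h => by
    linarith [hB x ξ, le_max_left (C + B) 1]⟩

/-! ### The Lagrangian -/

theorem bddAbove_legendre (h1 : AssumptionH1 H) (x : Tn n) (v : Rn n) :
    BddAbove (Set.range fun ξ : Rn n => inner ℝ ξ v - H x ξ) := by
  obtain ⟨B, hB⟩ := h1.exists_mul_norm_sub_le ‖v‖
  refine ⟨B, ?_⟩
  rintro _ ⟨ξ, rfl⟩
  have := real_inner_le_norm ξ v
  simp only
  linarith [hB x ξ, mul_comm ‖ξ‖ ‖v‖]

/-- The Fenchel-Young inequality. -/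
theorem inner_sub_le_lagrangian (h1 : AssumptionH1 H) (x : Tn n) (v ξ : Rn n) :
    inner ℝ ξ v - H x ξ ≤ lagrangian H x v :=
  le_ciSup (h1.bddAbove_legendre x v) ξ

/-- Equality in the Fenchel-Young inequality at conjugate points `v = D_ξ H(x, ξ)`. -/
theorem lagrangian_gradient (h1 : AssumptionH1 H) (x : Tn n) (ξ : Rn n) :
    lagrangian H x (gradient (H x) ξ) = inner ℝ ξ (gradient (H x) ξ) - H x ξ := by
  refine le_antisymm (ciSup_le fun η => ?_) (h1.inner_sub_le_lagrangian x _ ξ)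
  have := h1.add_inner_gradient_le x ξ η
  rw [inner_sub_right, real_inner_comm, real_inner_comm ξ] at this
  linarith

theorem measurable_lagrangian (h1 : AssumptionH1 H) :
    Measurable fun z : Tn n × Rn n => lagrangian H z.1 z.2 := by
  have hc : ∀ ξ : Rn n, Continuous fun z : Tn n × Rn n => inner ℝ ξ z.2 - H z.1 ξ := fun ξ =>
    (continuous_const.inner continuous_snd).sub
      (h1.continuous.comp (continuous_fst.prodMk continuous_const))
  have h : LowerSemicontinuous fun z : Tn n × Rn n => ⨆ ξ : Rn n, (inner ℝ ξ z.2 - H z.1 ξ) :=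
    lowerSemicontinuous_ciSup (f := fun (ξ : Rn n) (z : Tn n × Rn n) => inner ℝ ξ z.2 - H z.1 ξ)
      (fun z => h1.bddAbove_legendre z.1 z.2) (fun ξ => (hc ξ).lowerSemicontinuous)
  exact h.measurable

theorem measurable_actionDensity (h1 : AssumptionH1 H) (p : Rn n) :
    Measurable (actionDensity H p) :=
  h1.measurable_lagrangian.sub (continuous_const.inner continuous_snd).measurable

end AssumptionH1

/-! ### Viscosity inequalities on `ℝⁿ` -/

/-- `U` satisfies `G(y, DU) ≤ g(y)` on `ℝⁿ` in the viscosity sense. A zeroth order term of the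
equation is put into the right hand side `g`. -/
def IsViscSub {n : ℕ} (G : Rn n → Rn n → ℝ) (g U : Rn n → ℝ) : Prop :=
  ∀ (φ : Rn n → ℝ) (y : Rn n), ContDiff ℝ 1 φ → IsLocalMax (fun z => U z - φ z) y →
    G y (gradient φ y) ≤ g y

/-- `U` satisfies `G(y, DU) ≥ g(y)` on `ℝⁿ` in the viscosity sense. -/
def IsViscSuper {n : ℕ} (G : Rn n → Rn n → ℝ) (g U : Rn n → ℝ) : Prop :=
  ∀ (φ : Rn n → ℝ) (y : Rn n), ContDiff ℝ 1 φ → IsLocalMin (fun z => U z - φ z) y →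
    g y ≤ G y (gradient φ y)

section Gradient

variable {n : ℕ}

theorem gradient_fun_neg (φ : Rn n → ℝ) (y : Rn n) :
    gradient (fun z => -φ z) y = -gradient φ y := by
  unfold gradient
  rw [fderiv_fun_neg, map_neg]

theorem gradient_eq_zero_of_isLocalMax_sub {φ ψ : Rn n → ℝ} {y : Rn n}
    (hφ : DifferentiableAt ℝ φ y) (hψ : DifferentiableAt ℝ ψ y)
    (h : IsLocalMax (fun z => φ z - ψ z) y) : gradient ψ y = gradient φ y := by
  have h0 := h.fderiv_eq_zero
  rw [fderiv_fun_sub hφ hψ, sub_eq_zero] at h0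
  unfold gradient
  rw [h0]

theorem gradient_add_const_mul_norm_sub_sq {φ : Rn n → ℝ} (hφ : Differentiable ℝ φ) (c : ℝ)
    (y z : Rn n) :
    gradient (fun w => φ w + c * ‖w - y‖ ^ 2) z = gradient φ z + (2 * c) • (z - y) := by
  have h1 : HasFDerivAt (fun w : Rn n => ‖w - y‖ ^ 2) (2 • innerSL ℝ (z - y)) z := by
    simpa using ((hasFDerivAt_id z).sub_const y).norm_sq
  have h2 : HasFDerivAt (fun w => φ w + c * ‖w - y‖ ^ 2)
      (fderiv ℝ φ z + c • (2 • innerSL ℝ (z - y))) z :=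
    (hφ z).hasFDerivAt.add (h1.const_mul c)
  apply ext_inner_right ℝ
  intro v
  rw [inner_gradient_left, h2.fderiv, inner_add_left, inner_gradient_left, inner_smul_left]
  simp [inner_sub_left]
  ring

theorem contDiff_add_const_mul_norm_sub_sq {φ : Rn n → ℝ} (hφ : ContDiff ℝ 1 φ) (c : ℝ)
    (y : Rn n) : ContDiff ℝ 1 fun w => φ w + c * ‖w - y‖ ^ 2 :=
  hφ.add (contDiff_const.mul ((contDiff_id.sub contDiff_const).norm_sq ℝ))

theorem continuous_gradient_of_contDiff {φ : Rn n → ℝ} (hφ : ContDiff ℝ 1 φ) :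
    Continuous (gradient φ) :=
  (InnerProductSpace.toDual ℝ (Rn n)).symm.continuous.comp
    (hφ.continuous_fderiv (by norm_num))

end Gradient

section Viscosity

variable {n : ℕ} {G : Rn n → Rn n → ℝ} {g U : Rn n → ℝ}

theorem isViscSuper_iff : IsViscSuper G g U ↔
    IsViscSub (fun y q => -G y (-q)) (fun y => -g y) fun y => -U y := by
  constructor
  · intro h φ y hφ hm
    have := h (fun z => -φ z) y hφ.neg (by simpa [sub_eq_add_neg, add_comm] using hm.neg)
    rw [gradient_fun_neg] at this
    exact neg_le_neg this
  · intro h φ y hφ hm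
    have := h (fun z => -φ z) y hφ.neg (by simpa [sub_eq_add_neg, add_comm] using hm.neg)
    rw [gradient_fun_neg] at this
    simpa using this

/-- The stability of viscosity subsolutions, in a form that serves both for suprema and for
locally uniform limits: only one approximating subsolution `W` for each accuracy is asked for. -/
theorem IsViscSub.of_approx (hG : Continuous fun z : Rn n × Rn n => G z.1 z.2)
    (h : ∀ y, ∀ ε > 0, ∃ ρ > 0, ∀ δ > 0, ∃ W g' : Rn n → ℝ, IsViscSub G g' W ∧ Continuous W ∧
      (∀ z ∈ Metric.closedBall y 1, W z ≤ U z + δ) ∧ U y - δ ≤ W y ∧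
      ∀ z ∈ Metric.closedBall y ρ, g' z ≤ g y + ε) :
    IsViscSub G g U := by
  intro φ y hφ hm
  refine le_of_forall_pos_le_add fun ε hε => ?_
  obtain ⟨ρ, hρ, hW⟩ := h y (ε / 2) (half_pos hε)
  have hc : Continuous fun z => G z (gradient φ z + (2 * (1 : ℝ)) • (z - y)) := by
    have h1 : Continuous fun z : Rn n => (2 * (1 : ℝ)) • (z - y) := by fun_prop
    exact hG.comp (continuous_id.prodMk ((continuous_gradient_of_contDiff hφ).add h1))
  have hy : G y (gradient φ y) - ε / 2 < G y (gradient φ y + (2 * (1 : ℝ)) • (y - y)) := by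
    simp [hε]
  obtain ⟨r₁, hr₁, h₁⟩ := Metric.eventually_nhds_iff_ball.1
    ((hc.tendsto y).eventually (lt_mem_nhds hy))
  obtain ⟨r₂, hr₂, h₂⟩ := Metric.eventually_nhds_iff_ball.1 hm
  -- On the sphere of radius `r` the quadratic perturbation costs `r ^ 2`, more than the error.
  set r := min (min (r₁ / 2) (r₂ / 2)) (min 1 ρ) with hr
  have hr0 : 0 < r := by positivity
  have hrr₁ : r ≤ r₁ / 2 := (min_le_left _ _).trans (min_le_left _ _)
  have hrr₂ : r ≤ r₂ / 2 := (min_le_left _ _).trans (min_le_right _ _)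
  have hr1 : r ≤ 1 := (min_le_right _ _).trans (min_le_left _ _)
  have hrρ : r ≤ ρ := (min_le_right _ _).trans (min_le_right _ _)
  obtain ⟨W, g', hsub, hcW, hWU, hUW, hg'⟩ := hW (r ^ 2 / 4) (by positivity)
  have hψ := contDiff_add_const_mul_norm_sub_sq hφ 1 y
  obtain ⟨z, hz, hzm⟩ := Metric.exists_isLocalMin_mem_ball
    (f := fun z => (φ z + 1 * ‖z - y‖ ^ 2) - W z) (a := y) (z := y) (r := r)
    (hψ.continuous.sub hcW).continuousOn (Metric.mem_closedBall_self hr0.le) (by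
      intro z hz
      have hzr : ‖z - y‖ = r := by simpa [dist_eq_norm] using hz
      have h3 := hWU z (Metric.closedBall_subset_closedBall hr1 (Metric.sphere_subset_closedBall hz))
      have h4 : U z - φ z ≤ U y - φ y := h₂ z (by
        rw [Metric.mem_ball, dist_eq_norm, hzr]; linarith)
      rw [hzr]
      simp only [sub_self, norm_zero]
      have : 0 < r ^ 2 := by positivity
      nlinarith)
  have hzm' : IsLocalMax (fun z => W z - (φ z + 1 * ‖z - y‖ ^ 2)) z := by
    simpa using hzm.neg
  have h5 := hsub _ z hψ hzm'
  rw [gradient_add_const_mul_norm_sub_sq (hφ.differentiable (by norm_num))] at h5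
  have h6 := h₁ z (Metric.ball_subset_ball (by linarith) hz)
  have h7 := hg' z (Metric.ball_subset_closedBall (Metric.ball_subset_ball hrρ hz))
  have h8 := h6.trans_le (h5.trans h7)
  linarith

/-- A function whose viscosity gradient is bounded by `M` is `M`-Lipschitz. -/
theorem IsViscSub.sub_le_of_norm {M K : ℝ} (hM : 0 ≤ M) (hU : Continuous U) (hK : ∀ z, U z ≤ K)
    (h : IsViscSub (fun _ q => ‖q‖) (fun _ => M) U) (y z : Rn n) : U z - U y ≤ M * ‖z - y‖ := by
  suffices hA : ∀ A > M, ∀ ε > 0, U z ≤ U y + A * ‖z - y‖ + ε by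
    have h1 : ∀ A > M, U z - U y ≤ A * ‖z - y‖ := fun A hA' => by
      linarith [le_of_forall_pos_le_add (hA A hA')]
    have h2 : Tendsto (fun A : ℝ => A * ‖z - y‖) (𝓝[>] M) (𝓝 (M * ‖z - y‖)) :=
      ((continuous_id.mul continuous_const).tendsto M).mono_left nhdsWithin_le_nhds
    exact ge_of_tendsto h2 (eventually_nhdsWithin_of_forall h1)
  intro A hA ε hε
  have hA0 : 0 < A := hM.trans_lt hA
  obtain ⟨η, hη, hUη⟩ := Metric.eventually_nhds_iff_ball.1
    ((hU.tendsto y).eventually (gt_mem_nhds (show U y < U y + ε / 2 by linarith)))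
  -- The penalty `A √(δ² + |z - y|²)` is a smooth substitute for the cone `A |z - y|`.
  obtain ⟨δ, hδ, hδ1, hδ2⟩ : ∃ δ > 0, A * δ ≤ ε / 2 ∧ M * δ < η * (A - M) := by
    have hAM : 0 < A - M := sub_pos.2 hA
    refine ⟨min (ε / (2 * A)) (η * (A - M) / (2 * (M + 1))), by positivity, ?_, ?_⟩
    · calc A * _ ≤ A * (ε / (2 * A)) := by gcongr; exact min_le_left _ _
        _ = ε / 2 := by field_simp
    · calc M * _ ≤ M * (η * (A - M) / (2 * (M + 1))) := by gcongr; exact min_le_right _ _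
        _ < (2 * (M + 1)) * (η * (A - M) / (2 * (M + 1))) := by gcongr; linarith
        _ = η * (A - M) := by field_simp
  set s : Rn n → ℝ := fun w => √(δ ^ 2 + ‖w - y‖ ^ 2) with hs
  have hpos : ∀ w : Rn n, δ ^ 2 + ‖w - y‖ ^ 2 ≠ 0 := fun w => by positivity
  have hs1 : ∀ w, ‖w - y‖ ≤ s w := fun w => Real.le_sqrt_of_sq_le (by nlinarith [sq_nonneg δ])
  have hs2 : ∀ w, s w ≤ δ + ‖w - y‖ := fun w => by
    refine Real.sqrt_le_iff.2 ⟨by positivity, ?_⟩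
    nlinarith [norm_nonneg (w - y)]
  have hsd : ContDiff ℝ 1 fun w => A * s w :=
    contDiff_const.mul ((contDiff_const.add
      ((contDiff_id.sub contDiff_const).norm_sq ℝ)).sqrt hpos)
  obtain ⟨w, hw⟩ := (hU.sub hsd.continuous).exists_forall_ge' y (by
    filter_upwards [(tendsto_norm_cocompact_atTop (E := Rn n)).eventually_ge_atTop
      ((K - U y + A * s y) / A + ‖y‖)] with w hw
    have h1 : (K - U y + A * s y) / A ≤ ‖w - y‖ := by linarith [norm_sub_norm_le w y]
    rw [div_le_iff₀ hA0] at h1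
    have := mul_le_mul_of_nonneg_left (hs1 w) hA0.le
    simp only [Pi.sub_apply]
    linarith [hK w])
  have hgrad := h _ w hsd (Filter.Eventually.of_forall hw)
  have hspos : 0 < s w := Real.sqrt_pos.2 (by positivity)
  have hder : HasFDerivAt (fun w => A * s w)
      (A • ((1 / (2 * s w)) • (2 • innerSL ℝ (w - y)))) w := by
    have h1 : HasFDerivAt (fun w : Rn n => δ ^ 2 + ‖w - y‖ ^ 2) (2 • innerSL ℝ (w - y)) w := by
      simpa using (((hasFDerivAt_id w).sub_const y).norm_sq).const_add (δ ^ 2)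
    exact (h1.sqrt (hpos w)).const_mul A
  have hin : A * ‖w - y‖ ^ 2 / s w ≤ M * ‖w - y‖ := by
    have h1 := real_inner_le_norm (gradient (fun w => A * s w) w) (w - y)
    rw [inner_gradient_left, hder.fderiv] at h1
    refine le_trans (le_of_eq ?_) (h1.trans (mul_le_mul_of_nonneg_right hgrad (norm_nonneg _)))
    have h2 : (innerSL ℝ (w - y)) (w - y) = ‖w - y‖ ^ 2 := by
      rw [innerSL_apply_apply, real_inner_self_eq_norm_sq]
    simp only [smul_apply, h2, smul_eq_mul, nsmul_eq_mul]
    field_simp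
    norm_num
  have hwη : ‖w - y‖ < η := by
    rcases (norm_nonneg (w - y)).eq_or_lt with h0 | h0
    · rwa [← h0]
    · rw [div_le_iff₀ hspos] at hin
      have h1 : A * ‖w - y‖ ≤ M * s w := by
        have : ‖w - y‖ * (A * ‖w - y‖) ≤ ‖w - y‖ * (M * s w) := by linarith
        exact le_of_mul_le_mul_left this h0
      have h2 : M * s w ≤ M * (δ + ‖w - y‖) := by gcongr; exact hs2 w
      have h3 : (A - M) * ‖w - y‖ < (A - M) * η := by linarith
      exact lt_of_mul_lt_mul_left h3 (sub_pos.2 hA).le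
  have h1 := hUη w (by rwa [Metric.mem_ball, dist_eq_norm])
  have h2 := hw z
  simp only [Pi.sub_apply] at h2
  have h3 := mul_le_mul_of_nonneg_left (hs2 z) hA0.le
  have h4 : 0 ≤ A * s w := by positivity
  linarith

theorem IsViscSub.lipschitz {M K : ℝ} (hM : 0 ≤ M) (hU : Continuous U) (hK : ∀ z, U z ≤ K)
    (hGM : ∀ y q, G y q ≤ g y → ‖q‖ ≤ M) (h : IsViscSub G g U) (y z : Rn n) :
    |U z - U y| ≤ M * ‖z - y‖ := by
  have h' : IsViscSub (fun _ q => ‖q‖) (fun _ => M) U := fun φ y hφ hm => hGM y _ (h φ y hφ hm)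
  rw [abs_le]
  have h1 := h'.sub_le_of_norm hM hU hK y z
  have h2 := h'.sub_le_of_norm hM hU hK z y
  rw [norm_sub_rev] at h2
  constructor <;> linarith

end Viscosity

/-! ### Perron's method for the discounted equation -/

section Perron

variable {n : ℕ} {G : Rn n → Rn n → ℝ}

theorem isViscSub_const {g : Rn n → ℝ} {A : ℝ} (h : ∀ y, G y 0 ≤ g y) :
    IsViscSub G g fun _ => A := by
  intro φ y hφ hm
  rw [gradient_eq_zero_of_isLocalMax_sub (φ := fun _ => A) (differentiableAt_const A)
    (hφ.differentiable (by norm_num) y) hm]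
  simpa using h y

/-- The class of competitors in Perron's construction for the discounted equation
`lam U + G(y, DU) = 0`: continuous subsolutions between the constant subsolution `A` and the
constant supersolution `B`. Periodicity is not imposed. -/
structure IsPerronCompetitor (G : Rn n → Rn n → ℝ) (lam A B : ℝ) (W : Rn n → ℝ) : Prop where
  continuous : Continuous W
  lower : ∀ y, A ≤ W y
  upper : ∀ y, W y ≤ B
  isViscSub : IsViscSub G (fun y => -lam * W y) W

/-- If a subsolution violates the supersolution inequality at `y`, then it can be raised near `y`
to a larger subsolution. -/
theorem IsPerronCompetitor.exists_lt {lam A B : ℝ} (hlam : 0 < lam) {U : Rn n → ℝ}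
    (hG : Continuous fun z : Rn n × Rn n => G z.1 z.2) (hB : ∀ y, -lam * B ≤ G y 0)
    (hU : IsPerronCompetitor G lam A B U) {φ : Rn n → ℝ} {y : Rn n} (hφ : ContDiff ℝ 1 φ)
    (hm : IsLocalMin (fun z => U z - φ z) y) (hlt : G y (gradient φ y) < -lam * U y) :
    ∃ W, IsPerronCompetitor G lam A B W ∧ U y < W y := by
  have hφd : Differentiable ℝ φ := hφ.differentiable (by norm_num)
  have hUB : U y < B := by
    refine lt_of_le_of_ne (hU.upper y) fun hUB => ?_
    -- At a maximum point of `U` the test function has a critical point.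
    have h1 : IsLocalMax (fun z => φ z - U y) y := by
      filter_upwards [hm] with z hz
      have := hU.upper z
      linarith
    have h2 : gradient φ y = 0 := by
      have h3 := h1.fderiv_eq_zero
      rw [fderiv_sub_const] at h3
      simp [gradient, h3]
    rw [h2, hUB] at hlt
    linarith [hB y]
  set θ : Rn n → ℝ := fun z => φ z + (-1) * ‖z - y‖ ^ 2 with hθ
  have hθc : ContDiff ℝ 1 θ := contDiff_add_const_mul_norm_sub_sq hφ (-1) y
  have hgθ : gradient θ y = gradient φ y := by
    rw [hθ, gradient_add_const_mul_norm_sub_sq hφd]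
    simp
  set gap := -lam * U y - G y (gradient φ y) with hgap
  have hgap0 : 0 < gap := by linarith
  -- `ψ = θ - θ y + U y + δ` is the raised test function.
  have hc1 : Continuous fun z => G z (gradient θ z) + lam * (θ z - θ y + U y) :=
    (hG.comp (continuous_id.prodMk (continuous_gradient_of_contDiff hθc))).add
      (continuous_const.mul ((hθc.continuous.sub continuous_const).add continuous_const))
  obtain ⟨r₁, hr₁, h₁⟩ := Metric.eventually_nhds_iff_ball.1 ((hc1.tendsto y).eventually
    (gt_mem_nhds (show G y (gradient θ y) + lam * (θ y - θ y + U y) < -(gap / 2) by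
      rw [hgθ]; simp only [sub_self, zero_add]; linarith)))
  have hc2 : Continuous fun z => θ z - θ y + U y :=
    (hθc.continuous.sub continuous_const).add continuous_const
  obtain ⟨r₂, hr₂, h₂⟩ := Metric.eventually_nhds_iff_ball.1 ((hc2.tendsto y).eventually
    (gt_mem_nhds (show θ y - θ y + U y < (U y + B) / 2 by
      simp only [sub_self, zero_add]; linarith)))
  obtain ⟨r₃, hr₃, h₃⟩ := Metric.eventually_nhds_iff_ball.1 hm
  set r := min r₁ (min r₂ r₃) with hr
  have hr0 : 0 < r := by positivity
  obtain ⟨δ, hδ, hδ1, hδ2, hδ3⟩ : ∃ δ > 0, lam * δ ≤ gap / 2 ∧ δ ≤ (B - U y) / 2 ∧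
      δ < (r / 2) ^ 2 := by
    have hBU : 0 < B - U y := sub_pos.2 hUB
    refine ⟨min (gap / 2 / lam) (min ((B - U y) / 2) ((r / 2) ^ 2 / 2)), by positivity, ?_,
      (min_le_right _ _).trans (min_le_left _ _), ?_⟩
    · calc lam * _ ≤ lam * (gap / 2 / lam) := by gcongr; exact min_le_left _ _
        _ = gap / 2 := by field_simp
    · have h0 : 0 < (r / 2) ^ 2 := by positivity
      exact ((min_le_right _ _).trans (min_le_right _ _)).trans_lt (by linarith)
  set ψ : Rn n → ℝ := fun z => θ z - θ y + U y + δ with hψ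
  have hψc : ContDiff ℝ 1 ψ := ((hθc.sub contDiff_const).add contDiff_const).add contDiff_const
  have hgψ : ∀ z, gradient ψ z = gradient θ z := fun z => by
    simp only [hψ, gradient, fderiv_add_const, fderiv_sub_const]
  -- Outside of the ball of radius `r / 2` the raised function lies below `U`.
  have hout : ∀ z, ‖z - y‖ < r → r / 2 ≤ ‖z - y‖ → ψ z < U z := by
    intro z hz hz2
    have h4 : U y - φ y ≤ U z - φ z := h₃ z (by
      rw [Metric.mem_ball, dist_eq_norm]
      exact hz.trans_le ((min_le_right _ _).trans (min_le_right _ _)))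
    have h5 : (r / 2) ^ 2 ≤ ‖z - y‖ ^ 2 := by gcongr
    simp only [hψ, hθ, sub_self, norm_zero]
    nlinarith
  classical
  set W : Rn n → ℝ := fun z => if ‖z - y‖ < r then max (U z) (ψ z) else U z with hW
  have hWin : ∀ z, ‖z - y‖ < r → W z = max (U z) (ψ z) := fun z hz => if_pos hz
  have hWout : ∀ z, r / 2 ≤ ‖z - y‖ → W z = U z := by
    intro z hz
    by_cases h : ‖z - y‖ < r
    · rw [hWin z h, max_eq_left (hout z h hz).le]
    · exact if_neg h
  have hWU : ∀ z, U z ≤ W z := by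
    intro z
    by_cases h : ‖z - y‖ < r
    · rw [hWin z h]; exact le_max_left _ _
    · rw [hWout z (by linarith [not_lt.1 h])]
  have hcn : Continuous fun z : Rn n => ‖z - y‖ := (continuous_id.sub continuous_const).norm
  refine ⟨W, ⟨?_, fun z => (hU.lower z).trans (hWU z), ?_, ?_⟩, ?_⟩
  · rw [continuous_iff_continuousAt]
    intro z
    by_cases h : ‖z - y‖ < r
    · refine (hU.continuous.max hψc.continuous).continuousAt.congr ?_
      filter_upwards [(hcn.tendsto z).eventually (gt_mem_nhds h)] with w hw
      exact (hWin w hw).symm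
    · refine hU.continuous.continuousAt.congr ?_
      filter_upwards [(hcn.tendsto z).eventually
        (lt_mem_nhds (show r / 2 < ‖z - y‖ by linarith [not_lt.1 h]))] with w hw
      exact (hWout w hw.le).symm
  · intro z
    by_cases h : ‖z - y‖ < r
    · rw [hWin z h]
      refine max_le (hU.upper z) ?_
      have := h₂ z (by
        rw [Metric.mem_ball, dist_eq_norm]
        exact h.trans_le ((min_le_right _ _).trans (min_le_left _ _)))
      simp only [hψ]
      linarith
    · rw [hWout z (by linarith [not_lt.1 h])]
      exact hU.upper z
  · intro χ z hχ hmax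
    change G z (gradient χ z) ≤ -lam * W z
    by_cases hWz : W z = U z
    · rw [hWz]
      refine hU.isViscSub χ z hχ ?_
      filter_upwards [hmax] with w hw
      have := hWU w
      linarith
    · have hz : ‖z - y‖ < r := by
        by_contra hcon
        exact hWz (hWout z (by linarith [not_lt.1 hcon]))
      have hWψ : W z = ψ z := by
        rw [hWin z hz] at hWz ⊢
        rcases max_choice (U z) (ψ z) with h | h
        · exact absurd h hWz
        · exact h
      have hmax' : IsLocalMax (fun w => ψ w - χ w) z := by
        filter_upwards [hmax, (hcn.tendsto z).eventually (gt_mem_nhds hz)] with w hw hw2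
        have h6 : ψ w ≤ W w := by rw [hWin w hw2]; exact le_max_right _ _
        linarith
      rw [gradient_eq_zero_of_isLocalMax_sub (hψc.differentiable (by norm_num) z)
        (hχ.differentiable (by norm_num) z) hmax', hgψ, hWψ]
      have h7 := h₁ z (by
        rw [Metric.mem_ball, dist_eq_norm]
        exact hz.trans_le (min_le_left _ _))
      simp only [hψ]
      linarith
  · rw [hWin y (by simpa using hr0)]
    refine lt_max_of_lt_right ?_
    simp only [hψ]
    linarith

/-- Perron's method: the discounted equation `lam U + G(y, DU) = 0` with periodic, coercive `G` has
a periodic Lipschitz viscosity solution. Periodicity comes for free, because the class of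
competitors is invariant under the deck transformations. -/
theorem exists_discounted_solution {lam A B M : ℝ} (hlam : 0 < lam) (hM : 0 ≤ M)
    (hG : Continuous fun z : Rn n × Rn n => G z.1 z.2)
    (hper : ∀ a : Rn n, torusProj a = 0 → ∀ y q, G (y + a) q = G y q)
    (hA : ∀ y, G y 0 ≤ -lam * A) (hB : ∀ y, -lam * B ≤ G y 0)
    (hGM : ∀ y q, G y q ≤ -lam * A → ‖q‖ ≤ M) :
    ∃ U : Rn n → ℝ, (∀ y, A ≤ U y ∧ U y ≤ B) ∧ (∀ y z, |U z - U y| ≤ M * ‖z - y‖) ∧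
      (∀ a : Rn n, torusProj a = 0 → ∀ y, U (y + a) = U y) ∧
      IsViscSub G (fun y => -lam * U y) U ∧ IsViscSuper G (fun y => -lam * U y) U := by
  have hAB : A ≤ B := by
    have := (hB 0).trans (hA 0)
    nlinarith
  have hLip : ∀ W, IsPerronCompetitor G lam A B W → ∀ y z, |W z - W y| ≤ M * ‖z - y‖ := by
    intro W hW y z
    refine hW.isViscSub.lipschitz hM hW.continuous hW.upper (fun y q hq => hGM y q ?_) y z
    have := hW.lower y
    nlinarith
  let S : Rn n → Set ℝ := fun y => (fun W : Rn n → ℝ => W y) '' {W | IsPerronCompetitor G lam A B W}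
  have hAc : IsPerronCompetitor G lam A B fun _ => A :=
    ⟨continuous_const, fun _ => le_rfl, fun _ => hAB, isViscSub_const hA⟩
  have hne : ∀ y, (S y).Nonempty := fun y => ⟨A, _, hAc, rfl⟩
  have hbd : ∀ y, BddAbove (S y) := fun y => ⟨B, by rintro _ ⟨W, hW, rfl⟩; exact IsPerronCompetitor.upper hW y⟩
  set U : Rn n → ℝ := fun y => sSup (S y) with hUdef
  have hle : ∀ W, IsPerronCompetitor G lam A B W → ∀ y, W y ≤ U y := fun W hW y =>
    le_csSup (hbd y) ⟨W, hW, rfl⟩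
  have hULip1 : ∀ y z, U z ≤ U y + M * ‖z - y‖ := by
    intro y z
    refine csSup_le (hne z) ?_
    rintro _ ⟨W, hW, rfl⟩
    have h1 := (abs_le.1 (hLip W hW y z)).2
    have h2 := hle W hW y
    simp only
    linarith
  have hULip : ∀ y z, |U z - U y| ≤ M * ‖z - y‖ := by
    intro y z
    have h1 := hULip1 y z
    have h2 := hULip1 z y
    rw [norm_sub_rev] at h2
    rw [abs_le]
    constructor <;> linarith
  have hUc : Continuous U := by
    refine (LipschitzWith.of_dist_le_mul (K := ⟨M, hM⟩) fun z y => ?_).continuous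
    rw [Real.dist_eq, dist_eq_norm]
    exact hULip y z
  have hUsub : IsViscSub G (fun y => -lam * U y) U := by
    refine IsViscSub.of_approx hG fun y ε hε => ?_
    have hD : 0 < lam * (M + 1) := by positivity
    refine ⟨ε / 2 / (lam * (M + 1)), by positivity, fun δ hδ => ?_⟩
    obtain ⟨_, ⟨W, hW, rfl⟩, hWy⟩ := exists_lt_of_lt_csSup (hne y)
      (show U y - min δ (ε / 2 / lam) < sSup (S y) by
        have : 0 < min δ (ε / 2 / lam) := by positivity
        simp only [hUdef]; linarith)
    refine ⟨W, _, hW.isViscSub, hW.continuous, fun z _ => by linarith [hle W hW z], ?_, ?_⟩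
    · simp only at hWy
      linarith [min_le_left δ (ε / 2 / lam)]
    · intro z hz
      rw [Metric.mem_closedBall, dist_eq_norm] at hz
      have h1 := (abs_le.1 (hLip W hW y z)).1
      have h2 : lam * (M * ‖z - y‖) ≤ ε / 2 := by
        calc lam * (M * ‖z - y‖) ≤ lam * ((M + 1) * (ε / 2 / (lam * (M + 1)))) := by
              gcongr; linarith
          _ = ε / 2 := by field_simp
      have h3 : lam * min δ (ε / 2 / lam) ≤ ε / 2 := by
        calc lam * _ ≤ lam * (ε / 2 / lam) := by gcongr; exact min_le_right _ _
          _ = ε / 2 := by field_simp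
      have h4 : lam * (U y - min δ (ε / 2 / lam) - M * ‖z - y‖) ≤ lam * W z := by
        refine mul_le_mul_of_nonneg_left ?_ hlam.le
        simp only at hWy
        linarith
      linarith
  have hUc' : IsPerronCompetitor G lam A B U :=
    ⟨hUc, hle _ hAc, fun y => csSup_le (hne y) (by rintro _ ⟨W, hW, rfl⟩; exact IsPerronCompetitor.upper hW y),
      hUsub⟩
  have hshift : ∀ a : Rn n, torusProj a = 0 → ∀ W, IsPerronCompetitor G lam A B W →
      IsPerronCompetitor G lam A B fun y => W (y + a) := by
    intro a ha W hW
    refine ⟨hW.continuous.comp (continuous_id.add continuous_const), fun y => hW.lower _,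
      fun y => hW.upper _, fun φ y hφ hm => ?_⟩
    have h1 := hW.isViscSub (fun z => φ (z - a)) (y + a)
      (hφ.comp (contDiff_id.sub contDiff_const)) (by
        have ht : Tendsto (fun z : Rn n => z - a) (𝓝 (y + a)) (𝓝 y) := by
          have : Continuous fun z : Rn n => z - a := by fun_prop
          simpa using this.tendsto (y + a)
        filter_upwards [ht.eventually hm] with z hz
        simpa using hz)
    have h2 : gradient (fun z => φ (z - a)) (y + a) = gradient φ y := by
      unfold gradient
      simp only [sub_eq_add_neg]
      rw [fderiv_comp_add_right, add_neg_cancel_right]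
    rwa [h2, hper a ha] at h1
  have hperU : ∀ a : Rn n, torusProj a = 0 → ∀ y, U (y + a) ≤ U y := by
    intro a ha y
    refine csSup_le (hne _) ?_
    rintro _ ⟨W, hW, rfl⟩
    exact hle _ (hshift a ha W hW) y
  refine ⟨U, fun y => ⟨hUc'.lower y, hUc'.upper y⟩, hULip, fun a ha y => ?_, hUsub, ?_⟩
  · refine le_antisymm (hperU a ha y) ?_
    have hna : torusProj (-a) = 0 := by
      rw [← zero_sub, torusProj_sub, torusProj_zero, ha, sub_zero]
    simpa using hperU (-a) hna (y + a)
  · intro φ y hφ hm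
    by_contra hcon
    obtain ⟨W, hW, hlt⟩ := hUc'.exists_lt hlam hG hB hφ hm (not_le.1 hcon)
    exact absurd (hle W hW y) (not_le.2 hlt)

end Perron

/-! ### The vanishing discount limit -/

section Limit

variable {n : ℕ} {G : Rn n → Rn n → ℝ} {ι : Type*} {F : Filter ι}

theorem eventually_abs_sub_le_of_lipschitz {V : ι → Rn n → ℝ} {V₀ : Rn n → ℝ} {M : ℝ} (hM : 0 ≤ M)
    (hV : ∀ i y z, |V i z - V i y| ≤ M * ‖z - y‖) (hV₀ : ∀ y z, |V₀ z - V₀ y| ≤ M * ‖z - y‖)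
    (h : ∀ y, Tendsto (fun i => V i y) F (𝓝 (V₀ y))) {K : Set (Rn n)} (hK : IsCompact K) {δ : ℝ}
    (hδ : 0 < δ) : ∀ᶠ i in F, ∀ z ∈ K, |V i z - V₀ z| ≤ δ := by
  have hr : 0 < δ / (3 * (M + 1)) := by positivity
  obtain ⟨t, -, ht, hcov⟩ := hK.finite_cover_balls hr
  have h1 : ∀ᶠ i in F, ∀ y ∈ t, |V i y - V₀ y| < δ / 3 := by
    rw [ht.eventually_all]
    intro y _
    have := (h y).eventually (Metric.ball_mem_nhds (V₀ y) (by positivity : 0 < δ / 3))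
    simpa [Real.dist_eq] using this
  filter_upwards [h1] with i hi z hz
  obtain ⟨y, hy, hzy⟩ := Set.mem_iUnion₂.1 (hcov hz)
  rw [Metric.mem_ball, dist_eq_norm] at hzy
  have h2 : M * ‖z - y‖ ≤ δ / 3 := by
    calc M * ‖z - y‖ ≤ (M + 1) * (δ / (3 * (M + 1))) := by gcongr; linarith
      _ = δ / 3 := by field_simp
  have h3 := abs_le.1 (hV i y z)
  have h4 := abs_le.1 (hV₀ y z)
  have h5 := abs_lt.1 (hi y hy)
  rw [abs_le]
  constructor <;> linarith

theorem IsViscSub.of_tendsto [F.NeBot] {V : ι → Rn n → ℝ} {V₀ : Rn n → ℝ} {g : ι → Rn n → ℝ}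
    {g₀ : Rn n → ℝ} {M : ℝ} (hM : 0 ≤ M) (hG : Continuous fun z : Rn n × Rn n => G z.1 z.2)
    (hV : ∀ i y z, |V i z - V i y| ≤ M * ‖z - y‖) (hV₀ : ∀ y z, |V₀ z - V₀ y| ≤ M * ‖z - y‖)
    (h : ∀ y, Tendsto (fun i => V i y) F (𝓝 (V₀ y)))
    (hg : ∀ y, ∀ ε > 0, ∀ᶠ i in F, ∀ z ∈ Metric.closedBall y 1, g i z ≤ g₀ y + ε)
    (hsub : ∀ i, IsViscSub G (g i) (V i)) : IsViscSub G g₀ V₀ := by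
  refine IsViscSub.of_approx hG fun y ε hε => ⟨1, one_pos, fun δ hδ => ?_⟩
  obtain ⟨i, hi1, hi2⟩ := ((hg y ε hε).and (eventually_abs_sub_le_of_lipschitz hM hV hV₀ h
    (isCompact_closedBall y 1) hδ)).exists
  refine ⟨V i, g i, hsub i, ?_, fun z hz => by linarith [(abs_le.1 (hi2 z hz)).2], ?_, hi1⟩
  · refine (LipschitzWith.of_dist_le_mul (K := ⟨M, hM⟩) fun z y => ?_).continuous
    rw [Real.dist_eq, dist_eq_norm]
    exact hV i y z
  · linarith [(abs_le.1 (hi2 y (Metric.mem_closedBall_self zero_le_one))).1]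

theorem IsViscSub.add_const {g U : Rn n → ℝ} (h : IsViscSub G g U) (c : ℝ) :
    IsViscSub G g fun y => U y + c := by
  intro φ y hφ hm
  refine h φ y hφ ?_
  filter_upwards [hm] with z hz
  linarith

/-- The vanishing discount limit: for periodic coercive `G` there are a constant `c` and a periodic
viscosity solution of `G(y, DU) = c`. -/
theorem exists_ergodic_solution {K M : ℝ} (hM : 0 ≤ M)
    (hG : Continuous fun z : Rn n × Rn n => G z.1 z.2)
    (hper : ∀ a : Rn n, torusProj a = 0 → ∀ y q, G (y + a) q = G y q)
    (hK : ∀ y, |G y 0| ≤ K) (hGM : ∀ y q, G y q ≤ K → ‖q‖ ≤ M) :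
    ∃ (c : ℝ) (U : Rn n → ℝ), Continuous U ∧
      (∀ a : Rn n, torusProj a = 0 → ∀ y, U (y + a) = U y) ∧
      IsViscSub G (fun _ => c) U ∧ IsViscSuper G (fun _ => c) U := by
  let lam : ℕ → ℝ := fun k => 1 / ((k : ℝ) + 1)
  have hlam : ∀ k, 0 < lam k := fun k => Nat.one_div_pos_of_nat
  have hlam0 : Tendsto lam atTop (𝓝 0) := tendsto_one_div_add_atTop_nhds_zero_nat
  have hmul : ∀ k, lam k * (K / lam k) = K := fun k => by
    have := (hlam k).ne'
    field_simp
  have hex := fun k => exists_discounted_solution (A := -(K / lam k)) (B := K / lam k) (hlam k) hM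
    hG hper (fun y => by linarith [(abs_le.1 (hK y)).2, hmul k])
    (fun y => by linarith [(abs_le.1 (hK y)).1, hmul k])
    (fun y q hq => hGM y q (by linarith [hmul k]))
  choose U hUb hULip hUper hUsub hUsup using hex
  let V : ℕ → Rn n → ℝ := fun k y => U k y + -U k 0
  have hVLip : ∀ k y z, |V k z - V k y| ≤ M * ‖z - y‖ := fun k y z => by
    simpa [V] using hULip k y z
  have hVb : ∀ k y, |V k y| ≤ M * ‖y‖ := fun k y => by
    simpa [V, sub_eq_add_neg] using hULip k 0 y
  -- Compactness is used through limits along an ultrafilter.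
  let F : Ultrafilter ℕ := hyperfilter ℕ
  have hF : (F : Filter ℕ) ≤ atTop := Nat.hyperfilter_le_atTop
  have hlim : ∀ (f : ℕ → ℝ) (R : ℝ), (∀ k, |f k| ≤ R) → ∃ l, Tendsto f F (𝓝 l) := by
    intro f R hf
    obtain ⟨l, -, hl⟩ := (isCompact_Icc (a := -R) (b := R)).ultrafilter_le_nhds (F.map f) (by
      rw [le_principal_iff, Ultrafilter.mem_coe, Ultrafilter.mem_map]
      exact Filter.univ_mem' fun k => abs_le.1 (hf k))
    exact ⟨l, hl⟩
  obtain ⟨c, hc⟩ := hlim (fun k => -lam k * U k 0) K fun k => by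
    have h1 := mul_le_mul_of_nonneg_left (hUb k 0).1 (hlam k).le
    have h2 := mul_le_mul_of_nonneg_left (hUb k 0).2 (hlam k).le
    rw [abs_le]
    constructor <;> linarith [hmul k]
  choose V₀ hV₀ using fun y => hlim (fun k => V k y) (M * ‖y‖) fun k => hVb k y
  have hV₀Lip : ∀ y z, |V₀ z - V₀ y| ≤ M * ‖z - y‖ := fun y z =>
    le_of_tendsto ((hV₀ z).sub (hV₀ y)).abs (Filter.Eventually.of_forall fun k => hVLip k y z)
  have hg : ∀ y, ∀ ε > 0, ∀ᶠ k in (F : Filter ℕ), ∀ z ∈ Metric.closedBall y 1,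
      |(-lam k * U k z) - c| ≤ ε := by
    intro y ε hε
    have h1 : Tendsto (fun k => lam k * (M * (‖y‖ + 1))) F (𝓝 0) := by
      simpa using (hlam0.mono_left hF).mul_const (M * (‖y‖ + 1))
    have h2 := hc.eventually (Metric.ball_mem_nhds c (by positivity : 0 < ε / 2))
    filter_upwards [h1.eventually (gt_mem_nhds (by positivity : 0 < ε / 2)), h2] with k hk1 hk2 z hz
    replace hk2 : |-lam k * U k 0 - c| < ε / 2 := hk2
    rw [abs_lt] at hk2
    have hz' : ‖z‖ ≤ ‖y‖ + 1 := by
      rw [Metric.mem_closedBall, dist_eq_norm] at hz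
      linarith [norm_sub_norm_le z y]
    have h3 : lam k * |V k z| ≤ lam k * (M * (‖y‖ + 1)) := by
      have := (hlam k).le
      gcongr
      exact (hVb k z).trans (by gcongr)
    have h4 : lam k * U k z = lam k * V k z + lam k * U k 0 := by simp only [V]; ring
    have h5 := mul_le_mul_of_nonneg_left (le_abs_self (V k z)) (hlam k).le
    have h6 := mul_le_mul_of_nonneg_left (neg_abs_le (V k z)) (hlam k).le
    rw [abs_le]
    constructor <;> linarith [hk2.1, hk2.2]
  refine ⟨c, V₀, ?_, fun a ha y => ?_, ?_, ?_⟩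
  · refine (LipschitzWith.of_dist_le_mul (K := ⟨M, hM⟩) fun z y => ?_).continuous
    rw [Real.dist_eq, dist_eq_norm]
    exact hV₀Lip y z
  · refine tendsto_nhds_unique (hV₀ (y + a)) ?_
    simpa only [V, hUper _ a ha] using hV₀ y
  · refine IsViscSub.of_tendsto (F := (F : Filter ℕ)) hM hG hVLip hV₀Lip hV₀ ?_
      fun k => (hUsub k).add_const _
    intro y ε hε
    filter_upwards [hg y ε hε] with k hk z hz
    linarith [(abs_le.1 (hk z hz)).2]
  · rw [isViscSuper_iff]
    refine IsViscSub.of_tendsto (F := (F : Filter ℕ)) (V := fun k y => -V k y)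
      (g := fun k y => -(-lam k * U k y)) hM
      (hG.comp (continuous_fst.prodMk continuous_snd.neg)).neg
      (fun k y z => ?_) (fun y z => ?_) (fun y => (hV₀ y).neg) ?_ fun k => ?_
    · rw [← abs_neg]
      simpa [sub_eq_add_neg, add_comm] using hVLip k y z
    · rw [← abs_neg]
      simpa [sub_eq_add_neg, add_comm] using hV₀Lip y z
    · intro y ε hε
      filter_upwards [hg y ε hε] with k hk z hz
      linarith [(abs_le.1 (hk z hz)).1]
    · have h1 := (isViscSuper_iff.1 (hUsup k)).add_const (U k 0)
      have h2 : (fun y => -V k y) = fun y => -U k y + U k 0 := by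
        funext y
        simp only [V]
        ring
      rw [h2]
      exact h1

end Limit

/-! ### Solvability of the cell problem -/

section Cell

variable {n : ℕ} {H : Tn n → Rn n → ℝ}

theorem AssumptionH1.exists_cellProblemSolvable (h1 : AssumptionH1 H) (p : Rn n) :
    ∃ c, CellProblemSolvable H p c := by
  obtain ⟨K, hK⟩ := (isCompact_range (f := fun x : Tn n => |H x p|)
    (h1.continuous.comp (continuous_id.prodMk continuous_const)).abs).bddAbove
  obtain ⟨M, hM, hHM⟩ := h1.exists_norm_le_of_le K
  obtain ⟨c, U, hUc, hUper, hUsub, hUsup⟩ :=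
    exists_ergodic_solution (G := fun y q => H (torusProj y) (p + q)) (K := K) (M := M + ‖p‖)
    (by positivity)
    (h1.continuous.comp ((continuous_torusProj.comp continuous_fst).prodMk
      (continuous_const.add continuous_snd)))
    (fun a ha y q => by rw [torusProj_add, ha, add_zero])
    (fun y => by simpa using hK ⟨torusProj y, rfl⟩)
    (fun y q hq => by
      have h2 := hHM _ _ hq
      have h3 := norm_sub_le (p + q) p
      rw [add_sub_cancel_left] at h3
      linarith)
  have hU : ∀ y, U (torusLift (torusProj y)) = U y := comp_torusLift_torusProj hUper
  refine ⟨c, fun x => U (torusLift x), ?_, fun φ y hφ hm => ?_, fun φ y hφ hm => ?_⟩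
  · rw [← continuous_comp_torusProj_iff]
    simpa only [hU] using hUc
  · simp only [hU] at hm
    exact hUsub φ y hφ hm
  · simp only [hU] at hm
    exact hUsup φ y hφ hm

end Cell

/-! ### Smooth approximate subsolutions -/

section Mollification

variable {n : ℕ}

/-- Mollification of a Lipschitz function: the derivative of the mollified function at `x` is an
average of the derivatives in the ball of radius `r` about `x`. -/
theorem exists_mollification {K : NNReal} {U : Rn n → ℝ} (hU : LipschitzWith K U) {r : ℝ}
    (hr : 0 < r) :
    ∃ V : Rn n → ℝ, ContDiff ℝ 2 V ∧ (∀ a, (∀ z, U (z + a) = U z) → ∀ z, V (z + a) = V z) ∧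
      ∀ (x : Rn n) (S : Set (StrongDual ℝ (Rn n))), Convex ℝ S → IsClosed S →
        (∀ᵐ z, z ∈ Metric.ball x r → fderiv ℝ U z ∈ S) → fderiv ℝ V x ∈ S := by
  let η : ContDiffBump (0 : Rn n) := ⟨r / 2, r, half_pos hr, half_lt_self hr⟩
  let w : Rn n → ℝ := η.normed volume
  have hwc : Continuous w := η.continuous_normed
  have hw0 : ∀ t, 0 ≤ w t := η.nonneg_normed
  let d : Rn n → ENNReal := fun t => ENNReal.ofReal (w t)
  have hd : Measurable d := hwc.measurable.ennreal_ofReal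
  let ν : Measure (Rn n) := volume.withDensity d
  have hint : Integrable w := hwc.integrable_of_hasCompactSupport η.hasCompactSupport_normed
  have hprob : IsProbabilityMeasure ν := by
    constructor
    rw [withDensity_apply _ MeasurableSet.univ, Measure.restrict_univ,
      ← ofReal_integral_eq_lintegral_ofReal hint (Eventually.of_forall hw0),
      η.integral_normed, ENNReal.ofReal_one]
  have hball : ∀ᵐ t ∂ν, t ∈ Metric.ball (0 : Rn n) r := by
    rw [ae_withDensity_iff hd]
    refine Eventually.of_forall fun t ht => ?_
    have h1 : t ∈ Function.support w := fun h0 => ht (by simp [d, h0])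
    rwa [η.support_normed_eq] at h1
  have hνac : ν ≪ volume := withDensity_absolutelyContinuous _ _
  let V : Rn n → ℝ := fun x => ∫ t, U (x - t) ∂ν
  have hVconv : V = convolution w U (ContinuousLinearMap.lsmul ℝ ℝ) volume := by
    funext x
    rw [convolution_def]
    simp only [V, ν]
    rw [integral_withDensity_eq_integral_toReal_smul hd (Eventually.of_forall fun t => by
      simp [d])]
    refine integral_congr_ae (Eventually.of_forall fun t => ?_)
    simp [d, ENNReal.toReal_ofReal (hw0 t)]
  have hVs : ContDiff ℝ 2 V := by
    rw [hVconv]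
    exact_mod_cast η.hasCompactSupport_normed.contDiff_convolution_left (n := (2 : ℕ)) _
      η.contDiff_normed (hU.continuous.locallyIntegrable)
  refine ⟨V, hVs, fun a ha z => ?_, fun x S hS hSc hmem => ?_⟩
  · simp only [V]
    congr 1
    funext t
    rw [add_sub_right_comm, ha]
  · have hsub : ∀ᵐ t ∂ν, DifferentiableAt ℝ U (x - t) :=
      hνac.ae_le ((quasiMeasurePreserving_sub_left volume x).ae hU.ae_differentiableAt)
    have hsubc : ∀ x : Rn n, Continuous fun t => U (x - t) := fun x =>
      hU.continuous.comp (continuous_const.sub continuous_id)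
    have hUi : Integrable (fun t => U (x - t)) ν := by
      refine Integrable.of_bound (hsubc x).aestronglyMeasurable (|U x| + K * r) ?_
      filter_upwards [hball] with t ht
      have h1 := hU.dist_le_mul (x - t) x
      rw [Real.dist_eq, dist_eq_norm, sub_sub_cancel_left, norm_neg] at h1
      have h2 : K * ‖t‖ ≤ K * r := by
        have : ‖t‖ ≤ r := by simpa using (Metric.ball_subset_closedBall ht)
        gcongr
      have h3 := abs_sub_abs_le_abs_sub (U (x - t)) (U x)
      rw [Real.norm_eq_abs]
      linarith
    have hfm : AEStronglyMeasurable (fun t => fderiv ℝ U (x - t)) ν :=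
      ((measurable_fderiv ℝ U).comp
        (continuous_const.sub continuous_id).measurable).aestronglyMeasurable
    obtain ⟨hi, hder⟩ := hasFDerivAt_integral_of_dominated_loc_of_lip (μ := ν) (𝕜 := ℝ)
      (F := fun x t => U (x - t)) (x₀ := x) (bound := fun _ => (K : ℝ)) (s := Set.univ)
      (F' := fun t => fderiv ℝ U (x - t)) univ_mem
      (Eventually.of_forall fun x => (hsubc x).aestronglyMeasurable) hUi hfm
      (Eventually.of_forall fun t => by
        rw [lipschitzOnWith_univ]
        have h1 : Real.nnabs (K : ℝ) = K := by ext; simp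
        rw [h1]
        refine LipschitzWith.of_dist_le_mul fun y z => ?_
        simpa using hU.dist_le_mul (y - t) (z - t))
      (integrable_const _)
      (hsub.mono fun t ht => by
        have := ht.hasFDerivAt.comp x ((hasFDerivAt_id x).sub_const t)
        rwa [ContinuousLinearMap.comp_id] at this)
    rw [hder.fderiv]
    refine hS.integral_mem hSc ?_ hi
    have h2 := hνac.ae_le ((quasiMeasurePreserving_sub_left volume x).ae hmem)
    filter_upwards [h2, hball] with t h3 ht
    refine h3 ?_
    rw [Metric.mem_ball, dist_eq_norm, sub_sub_cancel_left, norm_neg]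
    simpa using ht

/-- A viscosity subsolution satisfies the inequality at each point of differentiability. -/
theorem IsViscSub.gradient_le {G : Rn n → Rn n → ℝ} {c : ℝ} {U : Rn n → ℝ}
    (hG : Continuous fun z : Rn n × Rn n => G z.1 z.2) (hU : Continuous U)
    (h : IsViscSub G (fun _ => c) U) {y : Rn n} (hd : DifferentiableAt ℝ U y) :
    G y (gradient U y) ≤ c := by
  set q := gradient U y with hq
  refine le_of_forall_pos_le_add fun ε hε => ?_
  obtain ⟨ρ, hρ, hGρ⟩ := Metric.eventually_nhds_iff_ball.1 ((hG.tendsto (y, q)).eventually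
    (lt_mem_nhds (show G y q - ε < G y q by linarith)))
  have hlit := (hasGradientAt_iff_isLittleO.1 hd.hasGradientAt).def (by positivity : 0 < ρ / 8)
  obtain ⟨r₀, hr₀, h₀⟩ := Metric.eventually_nhds_iff_ball.1 hlit
  set r := min (r₀ / 2) (ρ / 2) with hr
  have hr0 : 0 < r := by positivity
  have hrr : r ≤ r₀ / 2 := min_le_left _ _
  have hrρ : r ≤ ρ / 2 := min_le_right _ _
  -- The quadratic term beats the error of linearization on the sphere of radius `r`.
  set φ : Rn n → ℝ := fun z => inner ℝ q z with hφ
  have hφc : ContDiff ℝ 1 φ := contDiff_const.inner ℝ contDiff_id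
  have hφg : ∀ z, gradient φ z = q := fun z => by
    have h1 : HasFDerivAt φ (innerSL ℝ q) z := (innerSL ℝ q).hasFDerivAt
    apply ext_inner_right ℝ
    intro v
    rw [inner_gradient_left, h1.fderiv, innerSL_apply_apply]
  have hψc := contDiff_add_const_mul_norm_sub_sq hφc (ρ / (4 * r)) y
  obtain ⟨z, hz, hzm⟩ := Metric.exists_isLocalMin_mem_ball
    (f := fun z => (φ z + ρ / (4 * r) * ‖z - y‖ ^ 2) - U z) (a := y) (z := y) (r := r)
    (hψc.continuous.sub hU).continuousOn (Metric.mem_closedBall_self hr0.le) (by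
      intro z hz
      have hzr : ‖z - y‖ = r := by simpa [dist_eq_norm] using hz
      have h1 := h₀ z (by rw [Metric.mem_ball, dist_eq_norm, hzr]; linarith)
      rw [Real.norm_eq_abs, hzr, ← hq] at h1
      have h2 := (abs_le.1 h1).2
      rw [inner_sub_right] at h2
      have h3 : ρ / (4 * r) * r ^ 2 = ρ / 4 * r := by field_simp
      rw [hzr, h3]
      simp only [hφ, sub_self, norm_zero]
      nlinarith [mul_pos hρ hr0])
  have hzm' : IsLocalMax (fun z => U z - (φ z + ρ / (4 * r) * ‖z - y‖ ^ 2)) z := by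
    simpa using hzm.neg
  have h5 := h _ z hψc hzm'
  rw [gradient_add_const_mul_norm_sub_sq (hφc.differentiable (by norm_num)), hφg] at h5
  rw [Metric.mem_ball, dist_eq_norm] at hz
  have h6 := hGρ (z, q + (2 * (ρ / (4 * r))) • (z - y)) (by
    rw [Metric.mem_ball, Prod.dist_eq, max_lt_iff, dist_eq_norm, dist_eq_norm, add_sub_cancel_left,
      norm_smul, Real.norm_of_nonneg (by positivity)]
    refine ⟨by linarith, ?_⟩
    calc 2 * (ρ / (4 * r)) * ‖z - y‖ ≤ 2 * (ρ / (4 * r)) * r := by gcongr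
      _ = ρ / 2 := by field_simp; norm_num
      _ < ρ := by linarith)
  simp only at h6
  linarith

end Mollification

/-! ### The effective Hamiltonian as a minimax value -/

section CellConstant

variable {n : ℕ} {H : Tn n → Rn n → ℝ}

/-- The levels `c` for which `H(x, p + Dφ) ≤ c` has a solution `φ` of class `C²`. Their infimum is
the effective Hamiltonian. -/
def smoothSubsolutionLevels (H : Tn n → Rn n → ℝ) (p : Rn n) : Set ℝ :=
  {c | ∃ φ : Tn n → ℝ, TorusContDiff 2 φ ∧ ∀ x, H x (p + torusGrad φ x) ≤ c}

/-- A smooth subsolution is itself a test function for the supersolution, at a minimum point of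
the difference. -/
theorem IsViscositySolution.le_of_mem {p : Rn n} {c : ℝ} {u : Tn n → ℝ}
    (hu : IsViscositySolution H p c u) {a : ℝ} (ha : a ∈ smoothSubsolutionLevels H p) : c ≤ a := by
  obtain ⟨φ, hφ, hle⟩ := ha
  have hφc : Continuous φ := continuous_comp_torusProj_iff.1 (ContDiff.continuous hφ)
  obtain ⟨x, -, hx⟩ := isCompact_univ.exists_isMinOn Set.univ_nonempty
    (hu.continuous.sub hφc).continuousOn
  have h := hu.supersolution (fun y => φ (torusProj y)) (torusLift x)
    (hφ.of_le (by norm_num)) (Eventually.of_forall fun z => by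
      have := hx (Set.mem_univ (torusProj z))
      simpa [torusProj_torusLift] using this)
  rw [torusProj_torusLift] at h
  exact h.trans (hle x)

theorem AssumptionH1.add_mem_smoothSubsolutionLevels (h1 : AssumptionH1 H) {p : Rn n} {c : ℝ}
    {u : Tn n → ℝ} (hu : IsViscositySolution H p c u) {ε : ℝ} (hε : 0 < ε) :
    c + ε ∈ smoothSubsolutionLevels H p := by
  set G : Rn n → Rn n → ℝ := fun y q => H (torusProj y) (p + q) with hGdef
  have hG : Continuous fun z : Rn n × Rn n => G z.1 z.2 :=
    h1.continuous.comp ((continuous_torusProj.comp continuous_fst).prodMk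
      (continuous_const.add continuous_snd))
  set U : Rn n → ℝ := fun y => u (torusProj y) with hUdef
  have hUc : Continuous U := hu.continuous.comp continuous_torusProj
  have hsub : IsViscSub G (fun _ => c) U := hu.subsolution
  obtain ⟨M, hM, hHM⟩ := h1.exists_norm_le_of_le c
  obtain ⟨K, hK⟩ := (isCompact_range hu.continuous).bddAbove
  have hGM : ∀ y q, G y q ≤ c → ‖q‖ ≤ M + ‖p‖ := fun y q hq => by
    have h2 := hHM _ _ hq
    have h3 := norm_sub_le (p + q) p
    rw [add_sub_cancel_left] at h3
    linarith
  have hM' : 0 ≤ M + ‖p‖ := by positivity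
  have hLip : LipschitzWith ⟨M + ‖p‖, hM'⟩ U := LipschitzWith.of_dist_le_mul fun z y => by
    rw [Real.dist_eq, dist_eq_norm]
    exact hsub.lipschitz hM' hUc (fun z => hK ⟨_, rfl⟩) hGM y z
  -- `H` varies by at most `ε` when the base point is shifted by less than `r`.
  have hcF : Continuous fun w : Rn n × (Tn n × Rn n) =>
      H w.2.1 (p + w.2.2) - H (w.2.1 + torusProj w.1) (p + w.2.2) := by
    refine (h1.continuous.comp (f := fun w : Rn n × (Tn n × Rn n) => (w.2.1, p + w.2.2))
      (by fun_prop)).sub (h1.continuous.comp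
      (f := fun w : Rn n × (Tn n × Rn n) => (w.2.1 + torusProj w.1, p + w.2.2)) ?_)
    exact (continuous_snd.fst.add (continuous_torusProj.comp continuous_fst)).prodMk
      (continuous_const.add continuous_snd.snd)
  have hev : ∀ᶠ t : Rn n in 𝓝 0, ∀ w ∈ (Set.univ : Set (Tn n)) ×ˢ
      Metric.closedBall (0 : Rn n) (M + ‖p‖),
      H w.1 (p + w.2) - H (w.1 + torusProj t) (p + w.2) < ε :=
    (isCompact_univ.prod (isCompact_closedBall _ _)).eventually_forall_of_forall_eventually
      fun w _ => (hcF.tendsto (0, w)).eventually (gt_mem_nhds (by simp [torusProj_zero, hε]))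
  obtain ⟨r, hr, hrε⟩ := Metric.eventually_nhds_iff_ball.1 hev
  obtain ⟨V, hV, hVper, hVmem⟩ := exists_mollification hLip hr
  have hVlift : ∀ y, V (torusLift (torusProj y)) = V y :=
    comp_torusLift_torusProj fun a ha => hVper a fun z => by
      simp only [hUdef, torusProj_add, ha, add_zero]
  have hVlift' : (fun y => V (torusLift (torusProj y))) = V := funext hVlift
  refine ⟨fun x => V (torusLift x), ?_, fun x => ?_⟩
  · unfold TorusContDiff
    rw [hVlift']
    exact_mod_cast hV
  · obtain ⟨y, rfl⟩ := surjective_torusProj x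
    rw [torusGrad_torusProj, hVlift']
    have hconv := (h1.convexOn (torusProj y)).convex_le (c + ε)
    have hclosed : IsClosed {q : Rn n | H (torusProj y) q ≤ c + ε} :=
      isClosed_le (h1.differentiable_fiber (torusProj y)).continuous continuous_const
    let T : StrongDual ℝ (Rn n) →ᵃ[ℝ] Rn n :=
      ((InnerProductSpace.toDual ℝ (Rn n)).symm.toContinuousLinearEquiv :
        StrongDual ℝ (Rn n) ≃L[ℝ] Rn n).toLinearMap.toAffineMap + AffineMap.const ℝ _ p
    have hT : ∀ l, T l = p + (InnerProductSpace.toDual ℝ (Rn n)).symm l := fun l => by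
      simp [T, add_comm]
    have hTc : Continuous T := by
      have : (T : StrongDual ℝ (Rn n) → Rn n) =
          fun l => p + (InnerProductSpace.toDual ℝ (Rn n)).symm l := funext hT
      rw [this]
      exact continuous_const.add (InnerProductSpace.toDual ℝ (Rn n)).symm.continuous
    have h := hVmem y (T ⁻¹' {q : Rn n | q ∈ Set.univ ∧ H (torusProj y) q ≤ c + ε})
      (hconv.affine_preimage T) (by
        simp only [Set.mem_univ, true_and]
        exact hclosed.preimage hTc) (by
        filter_upwards [hLip.ae_differentiableAt (μ := volume)] with z hz hzr
        rw [Set.mem_preimage, hT]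
        refine ⟨Set.mem_univ _, ?_⟩
        have h2 := hsub.gradient_le hG hUc hz
        have h3 := hrε (z - y) (by simpa [dist_eq_norm] using hzr) (torusProj y, gradient U z)
          ⟨Set.mem_univ _, by simpa using hGM z _ h2⟩
        rw [← torusProj_add, add_sub_cancel] at h3
        simp only [hGdef] at h2
        change H (torusProj y) (p + gradient U z) ≤ c + ε
        linarith)
    rw [Set.mem_preimage, hT] at h
    exact h.2

/-- The cell problem pins down its constant as the infimum of the levels of smooth
subsolutions. -/
theorem AssumptionH1.isGLB_of_cellProblemSolvable (h1 : AssumptionH1 H) {p : Rn n} {c : ℝ}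
    (h : CellProblemSolvable H p c) : IsGLB (smoothSubsolutionLevels H p) c := by
  obtain ⟨u, hu⟩ := h
  refine ⟨fun a ha => hu.le_of_mem ha, fun b hb => le_of_forall_pos_le_add fun ε hε => ?_⟩
  exact hb (h1.add_mem_smoothSubsolutionLevels hu hε)

theorem AssumptionH1.existsUnique_cellProblemSolvable (h1 : AssumptionH1 H) (p : Rn n) :
    ∃! c : ℝ, CellProblemSolvable H p c := by
  obtain ⟨c, hc⟩ := h1.exists_cellProblemSolvable p
  exact ⟨c, hc, fun b hb =>
    (h1.isGLB_of_cellProblemSolvable hb).unique (h1.isGLB_of_cellProblemSolvable hc)⟩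

theorem AssumptionH1.isGLB_effectiveHamiltonian (h1 : AssumptionH1 H) (p : Rn n) :
    IsGLB (smoothSubsolutionLevels H p) (effectiveHamiltonian H p) :=
  h1.isGLB_of_cellProblemSolvable (Classical.epsilon_spec (h1.exists_cellProblemSolvable p))

theorem AssumptionH1.exists_smooth_subsolution (h1 : AssumptionH1 H) (p : Rn n) {ε : ℝ}
    (hε : 0 < ε) : ∃ φ : Tn n → ℝ, TorusContDiff 2 φ ∧
      ∀ x, H x (p + torusGrad φ x) ≤ effectiveHamiltonian H p + ε := by
  obtain ⟨a, ⟨φ, hφ, hle⟩, -, ha⟩ := (h1.isGLB_effectiveHamiltonian p).exists_between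
    (lt_add_of_pos_right (effectiveHamiltonian H p) hε)
  exact ⟨φ, hφ, fun x => (hle x).trans ha.le⟩

theorem AssumptionH1.effectiveHamiltonian_le (h1 : AssumptionH1 H) {p : Rn n} {a : ℝ}
    {φ : Tn n → ℝ} (hφ : TorusContDiff 2 φ) (h : ∀ x, H x (p + torusGrad φ x) ≤ a) :
    effectiveHamiltonian H p ≤ a :=
  (h1.isGLB_effectiveHamiltonian p).1 ⟨φ, hφ, h⟩

theorem AssumptionH1.convexOn_effectiveHamiltonian (h1 : AssumptionH1 H) :
    ConvexOn ℝ Set.univ (effectiveHamiltonian H) := by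
  refine ⟨convex_univ, fun p _ q _ s t hs ht hst => le_of_forall_pos_le_add fun ε hε => ?_⟩
  obtain ⟨φ, hφ, hφle⟩ := h1.exists_smooth_subsolution p hε
  obtain ⟨ψ, hψ, hψle⟩ := h1.exists_smooth_subsolution q hε
  refine h1.effectiveHamiltonian_le (hφ.linear_combination hψ s t) fun x => ?_
  rw [torusGrad_linear_combination (by norm_num) hφ hψ]
  have e : s • p + t • q + (s • torusGrad φ x + t • torusGrad ψ x) =
      s • (p + torusGrad φ x) + t • (q + torusGrad ψ x) := by module
  have h2 := (h1.convexOn x).2 (Set.mem_univ (p + torusGrad φ x)) (Set.mem_univ (q + torusGrad ψ x))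
    hs ht hst
  have h3 := mul_le_mul_of_nonneg_left (hφle x) hs
  have h4 := mul_le_mul_of_nonneg_left (hψle x) ht
  rw [e]
  simp only [smul_eq_mul] at h2 ⊢
  have h5 : s * ε + t * ε = ε := by rw [← add_mul, hst, one_mul]
  linarith

end CellConstant

/-! ### Holonomic measures and the effective Hamiltonian -/

section Duality

variable {n : ℕ} {H : Tn n → Rn n → ℝ}

theorem IsHolonomic.integrable_inner {ν : Measure (Tn n × Rn n)} (hν : IsHolonomic ν) (ξ : Rn n) :
    Integrable (fun z : Tn n × Rn n => inner ℝ z.2 ξ) ν := by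
  refine (hν.integrable_norm.mul_const ‖ξ‖).mono'
    (continuous_snd.inner continuous_const).aestronglyMeasurable
    (Eventually.of_forall fun z => ?_)
  exact norm_inner_le_norm _ _

theorem actionDensity_add_smul (p ξ : Rn n) (t : ℝ) (z : Tn n × Rn n) :
    actionDensity H (p + t • ξ) z = actionDensity H p z - t * inner ℝ z.2 ξ := by
  unfold actionDensity
  rw [inner_add_left, inner_smul_left, real_inner_comm z.2 ξ]
  simp
  ring

/-- Weak duality: integrate the Fenchel-Young inequality along the gradient of a smooth approximate
subsolution. -/
theorem AssumptionH1.neg_effectiveHamiltonian_le (h1 : AssumptionH1 H) (p : Rn n)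
    {ν : Measure (Tn n × Rn n)} (hν : IsHolonomic ν) (hi : Integrable (actionDensity H p) ν) :
    -effectiveHamiltonian H p ≤ ∫ z, actionDensity H p z ∂ν := by
  refine le_of_forall_pos_le_add fun ε hε => ?_
  obtain ⟨φ, hφ, hle⟩ := h1.exists_smooth_subsolution p hε
  have := hν.isProbabilityMeasure
  have hDφ : Continuous (torusGrad φ) := hφ.continuous_torusGrad (by norm_num)
  obtain ⟨K, hK⟩ := (isCompact_range hDφ.norm).bddAbove
  have hint : Integrable (fun z : Tn n × Rn n => inner ℝ z.2 (torusGrad φ z.1)) ν := by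
    refine (hν.integrable_norm.mul_const K).mono'
      (continuous_snd.inner (hDφ.comp continuous_fst)).aestronglyMeasurable
      (Eventually.of_forall fun z => (norm_inner_le_norm _ _).trans ?_)
    gcongr
    exact hK ⟨z.1, rfl⟩
  have h2 : ∫ z : Tn n × Rn n, (inner ℝ z.2 (torusGrad φ z.1) -
      (effectiveHamiltonian H p + ε)) ∂ν ≤ ∫ z, actionDensity H p z ∂ν := by
    refine integral_mono (hint.sub (integrable_const _)) hi fun z => ?_
    have h3 := h1.inner_sub_le_lagrangian z.1 z.2 (p + torusGrad φ z.1)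
    have h4 := hle z.1
    rw [inner_add_left, real_inner_comm z.2 (torusGrad φ z.1)] at h3
    simp only [actionDensity]
    linarith
  rw [integral_sub hint (integrable_const _), hν.integral_eq_zero φ hφ] at h2
  simp at h2
  linarith

/-- Below a given level, `H x` is determined by its tangent hyperplanes at the momenta in a large
ball. The condition on tangent hyperplanes is, unlike a bound on `Q`, stable under averaging of
`(Q, a)`. -/
theorem AssumptionH1.exists_radius (h1 : AssumptionH1 H) (C : ℝ) :
    ∃ M : ℝ, 0 < M ∧ ∀ x Q a, a ≤ C →
      (∀ P ∈ Metric.closedBall (0 : Rn n) M,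
        H x P + inner ℝ (gradient (H x) P) (Q - P) ≤ a) → H x Q ≤ a := by
  obtain ⟨K, hK⟩ := (isCompact_range (f := fun x : Tn n => H x 0)
    (h1.continuous.comp (continuous_id.prodMk continuous_const))).bddAbove
  obtain ⟨M₀, hM₀, hHM⟩ := h1.exists_norm_le_of_le (max C K)
  refine ⟨M₀ + 1, by linarith, fun x Q a ha hQ => ?_⟩
  by_cases hQM : ‖Q‖ ≤ M₀ + 1
  · simpa using hQ Q (by simpa using hQM)
  · exfalso
    rw [not_le] at hQM
    have hM1 : 0 < M₀ + 1 := by linarith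
    have hQ0 : 0 < ‖Q‖ := hM1.trans hQM
    set P : Rn n := ((M₀ + 1) / ‖Q‖) • Q with hP
    have hPn : ‖P‖ = M₀ + 1 := by
      rw [hP, norm_smul, Real.norm_of_nonneg (by positivity)]
      field_simp
    have hPlt : max C K < H x P := by
      by_contra hcon
      linarith [hHM x P (not_lt.1 hcon)]
    have h2 := h1.add_inner_gradient_le x P 0
    have h3 : Q - P = (‖Q‖ / (M₀ + 1) - 1) • P := by
      rw [hP, smul_smul, sub_mul, sub_smul]
      have : ‖Q‖ / (M₀ + 1) * ((M₀ + 1) / ‖Q‖) = 1 := by field_simp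
      rw [this, one_smul, one_mul]
    have h4 := hQ P (by simp [hPn])
    rw [h3, inner_smul_right] at h4
    rw [zero_sub, inner_neg_right] at h2
    have h5 : H x 0 ≤ K := hK ⟨x, rfl⟩
    have h6 : 0 < inner ℝ (gradient (H x) P) P := by linarith [le_max_right C K]
    have h7 : 0 < ‖Q‖ / (M₀ + 1) - 1 := by
      rw [sub_pos, lt_div_iff₀ hM1]
      linarith
    linarith [mul_pos h7 h6, le_max_left C K]

/-- The positivity that makes the Hahn-Banach argument work. The momenta range over a fixed ball;
no bound on `φ` is assumed, so it is not clear that the inequality extends to all momenta. It does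
after averaging with a nearly optimal smooth subsolution, and this is enough, because `s ↦ s * d`
is assumed to support the effective Hamiltonian at `p`. -/
theorem AssumptionH1.exists_radius_nonneg (h1 : AssumptionH1 H) (p ξ : Rn n) (d : ℝ)
    (hd : ∀ s : ℝ, effectiveHamiltonian H p + s * d ≤ effectiveHamiltonian H (p + s • ξ)) :
    ∃ M : ℝ, 0 < M ∧ ∀ (α s β : ℝ) (φ : Tn n → ℝ), 0 ≤ β → TorusContDiff 2 φ →
      (∀ x, ∀ P ∈ Metric.closedBall (0 : Rn n) M,
        0 ≤ α + inner ℝ (gradient (H x) P) (torusGrad φ x) + s * inner ℝ (gradient (H x) P) ξ +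
          β * (inner ℝ (gradient (H x) P) (P - p) - H x P)) →
      0 ≤ α + s * d - β * effectiveHamiltonian H p := by
  set c := effectiveHamiltonian H p with hc
  obtain ⟨M, hM, hMQ⟩ := h1.exists_radius (c + 1)
  have hpos : ∀ (α s β : ℝ) (φ : Tn n → ℝ), 0 < β → TorusContDiff 2 φ →
      (∀ x, ∀ P ∈ Metric.closedBall (0 : Rn n) M,
        0 ≤ α + inner ℝ (gradient (H x) P) (torusGrad φ x) + s * inner ℝ (gradient (H x) P) ξ +
          β * (inner ℝ (gradient (H x) P) (P - p) - H x P)) →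
      0 ≤ α + s * d - β * c := by
    intro α s β φ hβ hφ h
    -- `θ` is so small that the averaged level stays below `c + 1`.
    obtain ⟨θ, hθ, hθ1, hθ2⟩ : ∃ θ > 0, θ ≤ 1 / 2 ∧ θ * |α / β - c| ≤ 1 / 2 := by
      refine ⟨1 / (2 * (|α / β - c| + 1)), by positivity, ?_, ?_⟩
      · rw [div_le_div_iff₀ (by positivity) (by positivity)]
        linarith [abs_nonneg (α / β - c)]
      · rw [div_mul_eq_mul_div, div_le_div_iff₀ (by positivity) (by positivity)]
        linarith [abs_nonneg (α / β - c)]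
    have hθα := mul_le_mul_of_nonneg_left (le_abs_self (α / β - c)) hθ.le
    have hmain : ∀ ε > 0, ε ≤ 1 / 2 → -ε ≤ θ * (α / β - c + s / β * d) := by
      intro ε hε hε2
      obtain ⟨φ₀, hφ₀, hle⟩ := h1.exists_smooth_subsolution p hε
      have key := h1.effectiveHamiltonian_le (p := p + (-(θ * (s / β))) • ξ)
        (a := (1 - θ) * (c + ε) + θ * (α / β))
        (hφ₀.linear_combination hφ (1 - θ) (-(θ / β))) fun x => by
          rw [torusGrad_linear_combination (by norm_num) hφ₀ hφ]
          refine hMQ x _ _ (by nlinarith) fun P hP => ?_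
          have e : p + (-(θ * (s / β))) • ξ + ((1 - θ) • torusGrad φ₀ x +
              (-(θ / β)) • torusGrad φ x) - P = (1 - θ) • (p + torusGrad φ₀ x - P) +
              θ • ((p - P) - (s / β) • ξ - (1 / β) • torusGrad φ x) := by
            rw [show θ / β = θ * (1 / β) by ring]
            module
          have h2 := (h1.add_inner_gradient_le x P (p + torusGrad φ₀ x)).trans (hle x)
          have h3 := h x P hP
          have h4 : H x P + inner ℝ (gradient (H x) P)
              ((p - P) - (s / β) • ξ - (1 / β) • torusGrad φ x) ≤ α / β := by
            rw [le_div_iff₀ hβ, inner_sub_right, inner_sub_right, inner_smul_right,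
              inner_smul_right]
            rw [← neg_sub p P, inner_neg_right] at h3
            have e2 : (H x P + (inner ℝ (gradient (H x) P) (p - P) -
                s / β * inner ℝ (gradient (H x) P) ξ -
                1 / β * inner ℝ (gradient (H x) P) (torusGrad φ x))) * β =
                β * (H x P + inner ℝ (gradient (H x) P) (p - P)) -
                s * inner ℝ (gradient (H x) P) ξ -
                inner ℝ (gradient (H x) P) (torusGrad φ x) := by
              field_simp
              ring
            rw [e2]
            linarith
          rw [e, inner_add_right, inner_smul_right, inner_smul_right]
          have h5 := mul_le_mul_of_nonneg_left h2 (by linarith : 0 ≤ 1 - θ)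
          have h6 := mul_le_mul_of_nonneg_left h4 hθ.le
          linarith
      have h7 := (hd (-(θ * (s / β)))).trans key
      nlinarith
    have h8 : 0 ≤ θ * (α / β - c + s / β * d) := by
      by_contra hcon
      rw [not_le] at hcon
      have h9 := hmain (min (1 / 2) (-(θ * (α / β - c + s / β * d)) / 2))
        (lt_min (by norm_num) (by linarith)) (min_le_left _ _)
      linarith [min_le_right (1 / 2) (-(θ * (α / β - c + s / β * d)) / 2)]
    have h10 := nonneg_of_mul_nonneg_right h8 hθ
    have h11 := mul_nonneg hβ.le h10
    have e3 : β * (α / β - c + s / β * d) = α + s * d - β * c := by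
      field_simp
      ring
    linarith
  refine ⟨M, hM, fun α s β φ hβ hφ h => ?_⟩
  -- The case `β = 0` follows by adding a small multiple of the bounded action density.
  have hcont : Continuous fun z : Tn n × Rn n =>
      inner ℝ (gradient (H z.1) z.2) (z.2 - p) - H z.1 z.2 :=
    (h1.continuous_gradient.inner (continuous_snd.sub continuous_const)).sub h1.continuous
  obtain ⟨k, hk⟩ := ((isCompact_univ.prod (isCompact_closedBall (0 : Rn n) M)).image
    hcont).bddBelow
  have hδ : ∀ δ > 0, 0 ≤ α - δ * k + s * d - (β + δ) * c := fun δ hδ => by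
    refine hpos _ s (β + δ) φ (by linarith) hφ fun x P hP => ?_
    have h2 := h x P hP
    have h3 := hk ⟨(x, P), ⟨Set.mem_univ _, hP⟩, rfl⟩
    have h4 := mul_le_mul_of_nonneg_left h3 hδ.le
    simp only at h4
    linarith
  have hlim : Tendsto (fun δ : ℝ => α - δ * k + s * d - (β + δ) * c) (𝓝[>] 0)
      (𝓝 (α - 0 * k + s * d - (β + 0) * c)) := by
    have : Continuous fun δ : ℝ => α - δ * k + s * d - (β + δ) * c := by fun_prop
    exact (this.tendsto 0).mono_left nhdsWithin_le_nhds
  have := ge_of_tendsto hlim (eventually_nhdsWithin_of_forall hδ)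
  simpa using this

/-- A normalized positive functional on `C(X)`, `X` compact, is integration against a probability
measure. -/
theorem exists_isProbabilityMeasure_integral_eq {X : Type*} [TopologicalSpace X] [CompactSpace X]
    [T2Space X] [MeasurableSpace X] [BorelSpace X] (g : C(X, ℝ) →ₗ[ℝ] ℝ)
    (hg : ∀ f : C(X, ℝ), (∀ x, 0 ≤ f x) → 0 ≤ g f) (hg1 : g 1 = 1) :
    ∃ m : Measure X, IsProbabilityMeasure m ∧ ∀ f : C(X, ℝ), ∫ x, f x ∂m = g f := by
  let Λ₀ : CompactlySupportedContinuousMap X ℝ →ₗ[ℝ] ℝ :=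
    { toFun := fun f => g f.toContinuousMap
      map_add' := fun f₁ f₂ => g.map_add f₁.toContinuousMap f₂.toContinuousMap
      map_smul' := fun a f => g.map_smul a f.toContinuousMap }
  let Λ : PositiveLinearMap ℝ (CompactlySupportedContinuousMap X ℝ) ℝ :=
    PositiveLinearMap.mk₀ Λ₀ fun f hf => hg _ fun x => hf x
  have hint : ∀ f : C(X, ℝ), ∫ x, f x ∂(RealRMK.rieszMeasure Λ) = g f := fun f =>
    RealRMK.integral_rieszMeasure Λ (CompactlySupportedContinuousMap.continuousMapEquiv f)
  refine ⟨RealRMK.rieszMeasure Λ, ⟨?_⟩, hint⟩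
  have h := hint 1
  rw [hg1] at h
  simp only [ContinuousMap.one_apply, integral_const, smul_eq_mul, mul_one] at h
  rw [Measure.real] at h
  rwa [ENNReal.toReal_eq_one_iff] at h

/-- Every supporting slope `d` of the effective Hamiltonian at `p` in the direction `ξ` is the mean
of `v · ξ` for a holonomic measure of minimal action. Such a measure is found by extending a
positive functional, in the momentum coordinates `v = D_ξ H(x, P)` with `P` in a large ball. -/
theorem AssumptionH1.exists_holonomic (h1 : AssumptionH1 H) (p ξ : Rn n) (d : ℝ)
    (hd : ∀ s : ℝ, effectiveHamiltonian H p + s * d ≤ effectiveHamiltonian H (p + s • ξ)) :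
    ∃ μ : Measure (Tn n × Rn n), IsHolonomic μ ∧ Integrable (actionDensity H p) μ ∧
      ∫ z, actionDensity H p z ∂μ ≤ -effectiveHamiltonian H p ∧
      ∫ z, inner ℝ z.2 ξ ∂μ = d := by
  obtain ⟨M, hM, hpos⟩ := h1.exists_radius_nonneg p ξ d hd
  set c := effectiveHamiltonian H p with hc
  let S : Set (Tn n × Rn n) := Set.univ ×ˢ Metric.closedBall (0 : Rn n) M
  have hS : CompactSpace S :=
    isCompact_iff_compactSpace.1 (isCompact_univ.prod (isCompact_closedBall _ _))
  let v : S → Rn n := fun z => gradient (H z.1.1) z.1.2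
  have hv : Continuous v := h1.continuous_gradient.comp continuous_subtype_val
  have hfst : Continuous fun z : S => z.1.1 := continuous_fst.comp continuous_subtype_val
  have hsnd : Continuous fun z : S => z.1.2 := continuous_snd.comp continuous_subtype_val
  let fD (φ : Tn n → ℝ) (hφ : TorusContDiff 2 φ) : C(S, ℝ) :=
    ⟨fun z => inner ℝ (v z) (torusGrad φ z.1.1),
      hv.inner ((hφ.continuous_torusGrad (by norm_num)).comp hfst)⟩
  let fξ : C(S, ℝ) := ⟨fun z => inner ℝ (v z) ξ, hv.inner continuous_const⟩
  let fL : C(S, ℝ) := ⟨fun z => inner ℝ (v z) (z.1.2 - p) - H z.1.1 z.1.2,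
    (hv.inner (hsnd.sub continuous_const)).sub (h1.continuous.comp continuous_subtype_val)⟩
  -- Nonnegative functions modulo the linear constraints that the measure has to satisfy.
  let cone : PointedCone ℝ C(S, ℝ) :=
    { carrier := {f | ∃ (φ : Tn n → ℝ) (_ : TorusContDiff 2 φ) (s β : ℝ), 0 ≤ β ∧
        ∀ z : S, inner ℝ (v z) (torusGrad φ z.1.1) + s * (inner ℝ (v z) ξ - d) -
          β * (fL z + c) ≤ f z}
      zero_mem' := ⟨fun _ => 0, torusContDiff_const 2 0, 0, 0, le_rfl, fun z => by
        simp [torusGrad_const]⟩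
      add_mem' := by
        rintro f₁ f₂ ⟨φ₁, hφ₁, s₁, β₁, hβ₁, h₁⟩ ⟨φ₂, hφ₂, s₂, β₂, hβ₂, h₂⟩
        refine ⟨_, hφ₁.linear_combination hφ₂ 1 1, s₁ + s₂, β₁ + β₂, add_nonneg hβ₁ hβ₂,
          fun z => ?_⟩
        rw [torusGrad_linear_combination (by norm_num) hφ₁ hφ₂, one_smul, one_smul,
          inner_add_right, ContinuousMap.add_apply]
        linarith [h₁ z, h₂ z]
      smul_mem' := by
        rintro ⟨a, ha⟩ f ⟨φ, hφ, s, β, hβ, h⟩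
        refine ⟨_, hφ.linear_combination (torusContDiff_const 2 0) a 0, a * s, a * β,
          mul_nonneg ha hβ, fun z => ?_⟩
        rw [torusGrad_linear_combination (by norm_num) hφ (torusContDiff_const 2 0), zero_smul,
          add_zero, inner_smul_right]
        have h2 := mul_le_mul_of_nonneg_left (h z) ha
        change _ ≤ a * f z
        linarith }
  have hnonneg : ∀ f : C(S, ℝ), (∀ z, 0 ≤ f z) → f ∈ cone := fun f hf =>
    ⟨fun _ => 0, torusContDiff_const 2 0, 0, 0, le_rfl, fun z => by
      simpa [torusGrad_const] using hf z⟩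
  have h10 : (1 : C(S, ℝ)) ≠ 0 := by
    intro h
    have := DFunLike.congr_fun h (⟨(0, 0), ⟨Set.mem_univ _, Metric.mem_closedBall_self hM.le⟩⟩ : S)
    simp at this
  obtain ⟨g, hg1, hg⟩ := riesz_extension cone
    (LinearPMap.mkSpanSingleton (K := ℝ) (1 : C(S, ℝ)) (1 : ℝ) h10) (by
      rintro ⟨f, hf⟩ hfc
      obtain ⟨t, rfl⟩ := Submodule.mem_span_singleton.1 hf
      rw [LinearPMap.mkSpanSingleton'_apply]
      obtain ⟨φ, hφ, s, β, hβ, h⟩ := hfc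
      have h2 := hpos (t + s * d + β * c) (-s) β _ hβ
        (hφ.linear_combination (torusContDiff_const 2 0) (-1) 0) (fun x P hP => by
          have h3 : inner ℝ (gradient (H x) P) (torusGrad φ x) +
              s * (inner ℝ (gradient (H x) P) ξ - d) -
              β * ((inner ℝ (gradient (H x) P) (P - p) - H x P) + c) ≤ t * 1 :=
            h ⟨(x, P), ⟨Set.mem_univ _, hP⟩⟩
          rw [torusGrad_linear_combination (by norm_num) hφ (torusContDiff_const 2 0), zero_smul,
            add_zero, inner_smul_right]
          linarith)
      simp only [RingHom.id_apply, smul_eq_mul, mul_one]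
      linarith) (by
      intro f
      refine ⟨⟨‖f‖ • 1, Submodule.smul_mem _ _ (Submodule.mem_span_singleton_self _)⟩,
        hnonneg _ fun z => ?_⟩
      have := (abs_le.1 (f.norm_coe_le_norm z)).1
      change 0 ≤ ‖f‖ * 1 + f z
      linarith)
  have hg1' : g 1 = 1 := by
    have h := hg1 ⟨1, Submodule.mem_span_singleton_self _⟩
    rwa [LinearPMap.mkSpanSingleton_apply] at h
  obtain ⟨m, hm, hmg⟩ := exists_isProbabilityMeasure_integral_eq g
    (fun f hf => hg f (hnonneg f hf)) hg1'
  have hgD : ∀ (φ : Tn n → ℝ) (hφ : TorusContDiff 2 φ), g (fD φ hφ) = 0 := by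
    intro φ hφ
    have h2 := hg (fD φ hφ) ⟨φ, hφ, 0, 0, le_rfl, fun z => by simp [fD]⟩
    have h3 := hg (-fD φ hφ) ⟨_, hφ.linear_combination (torusContDiff_const 2 0) (-1) 0, 0, 0,
      le_rfl, fun z => by
        rw [torusGrad_linear_combination (by norm_num) hφ (torusContDiff_const 2 0)]
        simp [fD]⟩
    rw [map_neg] at h3
    linarith
  have hgξ : g fξ = d := by
    have h2 := hg (fξ - d • 1) ⟨fun _ => 0, torusContDiff_const 2 0, 1, 0, le_rfl, fun z => by
      simp [torusGrad_const, fξ]⟩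
    have h3 := hg (-(fξ - d • 1)) ⟨fun _ => 0, torusContDiff_const 2 0, -1, 0, le_rfl, fun z => by
      simp [torusGrad_const, fξ]⟩
    rw [map_neg] at h3
    rw [map_sub, map_smul, hg1', smul_eq_mul, mul_one] at h2 h3
    linarith
  have hgL : g fL ≤ -c := by
    have h2 := hg (-(fL + c • 1)) ⟨fun _ => 0, torusContDiff_const 2 0, 0, 1, zero_le_one,
      fun z => by simp [torusGrad_const]⟩
    rw [map_neg, map_add, map_smul, hg1', smul_eq_mul, mul_one] at h2
    linarith
  have hΦ : Continuous fun z : S => (z.1.1, v z) := hfst.prodMk hv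
  have hact : ∀ z : S, actionDensity H p (z.1.1, v z) = fL z := by
    intro z
    change lagrangian H z.1.1 (gradient (H z.1.1) z.1.2) - inner ℝ p (v z) = _
    rw [h1.lagrangian_gradient]
    change inner ℝ z.1.2 (v z) - H z.1.1 z.1.2 - inner ℝ p (v z) =
      inner ℝ (v z) (z.1.2 - p) - H z.1.1 z.1.2
    rw [inner_sub_right, real_inner_comm z.1.2, real_inner_comm p]
    ring
  have hfi : ∀ f : C(S, ℝ), Integrable f m := fun f =>
    Integrable.of_bound f.continuous.aestronglyMeasurable ‖f‖
      (Eventually.of_forall fun z => f.norm_coe_le_norm z)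
  have hmeas := h1.measurable_actionDensity p
  refine ⟨m.map fun z : S => (z.1.1, v z), ⟨?_, ?_, fun φ hφ => ?_⟩, ?_, ?_, ?_⟩
  · exact Measure.isProbabilityMeasure_map hΦ.measurable.aemeasurable
  · rw [integrable_map_measure continuous_snd.norm.aestronglyMeasurable hΦ.measurable.aemeasurable]
    exact hfi ⟨fun z => ‖v z‖, hv.norm⟩
  · rw [integral_map hΦ.measurable.aemeasurable (continuous_snd.inner
      ((hφ.continuous_torusGrad (by norm_num)).comp continuous_fst)).aestronglyMeasurable]
    exact (hmg (fD φ hφ)).trans (hgD φ hφ)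
  · rw [integrable_map_measure hmeas.aestronglyMeasurable hΦ.measurable.aemeasurable]
    exact (hfi fL).congr (Eventually.of_forall fun z => (hact z).symm)
  · rw [integral_map hΦ.measurable.aemeasurable hmeas.aestronglyMeasurable]
    simp only [hact]
    rw [hmg]
    exact hgL
  · rw [integral_map hΦ.measurable.aemeasurable
      (continuous_snd.inner continuous_const).aestronglyMeasurable]
    exact (hmg fξ).trans hgξ

end Duality

/-! ### Derivatives of the effective Hamiltonian -/

section Derivative

variable {n : ℕ} {H : Tn n → Rn n → ℝ}

theorem AssumptionH1.integral_actionDensity_of_mem (h1 : AssumptionH1 H) {p : Rn n}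
    {μ : Measure (Tn n × Rn n)} (hμ : μ ∈ matherMeasures H p) :
    ∫ z, actionDensity H p z ∂μ = -effectiveHamiltonian H p := by
  obtain ⟨ν, hν, hνi, hνle, -⟩ := h1.exists_holonomic p 0 0 (by simp)
  exact le_antisymm ((hμ.2.2 ν hν hνi).trans hνle) (h1.neg_effectiveHamiltonian_le p hμ.1 hμ.2.1)

theorem AssumptionH1.add_mul_integral_le (h1 : AssumptionH1 H) {p : Rn n}
    {μ : Measure (Tn n × Rn n)} (hμ : μ ∈ matherMeasures H p) (ξ : Rn n) (t : ℝ) :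
    effectiveHamiltonian H p + t * ∫ z, inner ℝ z.2 ξ ∂μ ≤ effectiveHamiltonian H (p + t • ξ) := by
  have hi := (hμ.1.integrable_inner ξ).const_mul t
  have hfun : actionDensity H (p + t • ξ) =
      fun z => actionDensity H p z - t * inner ℝ z.2 ξ :=
    funext fun z => actionDensity_add_smul p ξ t z
  have h := h1.neg_effectiveHamiltonian_le (p + t • ξ) hμ.1 (by
    rw [hfun]; exact hμ.2.1.sub hi)
  rw [hfun, integral_sub hμ.2.1 hi, h1.integral_actionDensity_of_mem hμ, integral_const_mul] at h
  linarith

theorem AssumptionH1.exists_mem_matherMeasures (h1 : AssumptionH1 H) (p ξ : Rn n) (d : ℝ)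
    (hd : ∀ s : ℝ, effectiveHamiltonian H p + s * d ≤ effectiveHamiltonian H (p + s • ξ)) :
    ∃ μ ∈ matherMeasures H p, ∫ z, inner ℝ z.2 ξ ∂μ = d := by
  obtain ⟨μ, hμ, hi, hle, hint⟩ := h1.exists_holonomic p ξ d hd
  exact ⟨μ, ⟨hμ, hi, fun ν hν hνi => hle.trans (h1.neg_effectiveHamiltonian_le p hν hνi)⟩, hint⟩

/-- A convex function on the line has a right derivative, and the latter is a supporting slope. -/
theorem ConvexOn.exists_tendsto_slope_right {f : ℝ → ℝ} (hf : ConvexOn ℝ Set.univ f) :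
    ∃ d, Tendsto (fun t => (f t - f 0) / t) (𝓝[>] 0) (𝓝 d) ∧ ∀ s, f 0 + s * d ≤ f s := by
  have h0 : (0 : ℝ) ∈ interior (Set.univ : Set ℝ) := by simp
  have hder := hf.hasDerivWithinAt_rightDeriv_of_mem_interior h0
  refine ⟨derivWithin f (Set.Ioi 0) 0, ?_, fun s => ?_⟩
  · have := (hasDerivWithinAt_iff_tendsto_slope' Set.self_notMem_Ioi).1 hder
    refine this.congr fun t => ?_
    rw [slope_def_field, sub_zero]
  · rcases lt_trichotomy s 0 with hs | rfl | hs
    · have h1 := (hf.slope_le_leftDeriv_of_mem_interior (Set.mem_univ s) h0 hs).trans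
        (hf.leftDeriv_le_rightDeriv_of_mem_interior h0)
      rw [slope_def_field, div_le_iff₀ (by linarith)] at h1
      linarith
    · simp
    · have h1 := hf.rightDeriv_le_slope_of_mem_interior h0 (Set.mem_univ s) hs
      rw [slope_def_field, le_div_iff₀ (by linarith)] at h1
      linarith

theorem AssumptionH1.exists_rightDeriv_isGreatest (h1 : AssumptionH1 H) (p ξ : Rn n) :
    ∃ d : ℝ,
      Tendsto (fun t : ℝ => (effectiveHamiltonian H (p + t • ξ) - effectiveHamiltonian H p) / t)
        (𝓝[>] 0) (𝓝 d) ∧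
      IsGreatest ((fun μ : Measure (Tn n × Rn n) => ∫ z, inner ℝ z.2 ξ ∂μ) ''
        matherMeasures H p) d := by
  have hconv : ConvexOn ℝ Set.univ fun t : ℝ => effectiveHamiltonian H (p + t • ξ) := by
    have := h1.convexOn_effectiveHamiltonian.comp_affineMap (AffineMap.lineMap p (p + ξ))
    rw [Set.preimage_univ] at this
    refine this.congr fun t _ => ?_
    simp [AffineMap.lineMap_apply, add_comm]
  obtain ⟨d, hd, hsup⟩ := hconv.exists_tendsto_slope_right
  simp only [zero_smul, add_zero] at hd hsup
  refine ⟨d, hd, h1.exists_mem_matherMeasures p ξ d hsup, ?_⟩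
  rintro _ ⟨μ, hμ, rfl⟩
  refine ge_of_tendsto hd (eventually_nhdsWithin_of_forall fun t ht => ?_)
  rw [le_div_iff₀ ht]
  linarith [h1.add_mul_integral_le hμ ξ t]

theorem AssumptionH1.exists_leftDeriv_isLeast (h1 : AssumptionH1 H) (p ξ : Rn n) :
    ∃ d : ℝ,
      Tendsto (fun t : ℝ => (effectiveHamiltonian H (p + t • ξ) - effectiveHamiltonian H p) / t)
        (𝓝[<] 0) (𝓝 d) ∧
      IsLeast ((fun μ : Measure (Tn n × Rn n) => ∫ z, inner ℝ z.2 ξ ∂μ) ''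
        matherMeasures H p) d := by
  obtain ⟨d, hd, ⟨μ, hμ, hμd⟩, hub⟩ := h1.exists_rightDeriv_isGreatest p (-ξ)
  have hneg : ∀ μ : Measure (Tn n × Rn n),
      ∫ z, inner ℝ z.2 (-ξ) ∂μ = -∫ z, inner ℝ z.2 ξ ∂μ := fun μ => by
    simp only [inner_neg_right, integral_neg]
  refine ⟨-d, ?_, ⟨μ, hμ, ?_⟩, ?_⟩
  · have ht : Tendsto (fun t : ℝ => -t) (𝓝[<] 0) (𝓝[>] 0) := by
      refine tendsto_nhdsWithin_iff.2 ⟨?_, eventually_nhdsWithin_of_forall fun t ht => ?_⟩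
      · have := (continuous_neg (G := ℝ)).tendsto 0
        rw [neg_zero] at this
        exact this.mono_left nhdsWithin_le_nhds
      · exact neg_pos.2 (Set.mem_Iio.1 ht)
    refine (hd.comp ht).neg.congr fun t => ?_
    simp only [Function.comp, smul_neg, neg_smul, neg_neg, div_neg]
  · rw [← hμd]
    simp only [hneg, neg_neg]
  · rintro _ ⟨ν, hν, rfl⟩
    have := hub ⟨ν, hν, rfl⟩
    simp only [hneg] at this ⊢
    linarith

/-- A convex function with a supporting hyperplane `a` at `p` and partial derivatives `a i` at `p`
is differentiable there: by Jensen's inequality, the error is controlled by its values on the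
coordinate axes. -/
theorem ConvexOn.hasGradientAt_of_partial {f : Rn n → ℝ} (hf : ConvexOn ℝ Set.univ f) {p a : Rn n}
    (hsup : ∀ y, f p + inner ℝ a y ≤ f (p + y))
    (hpart : ∀ i, HasDerivAt (fun t : ℝ => f (p + t • EuclideanSpace.single i (1 : ℝ))) (a i) 0) :
    HasGradientAt f a p := by
  rw [hasGradientAt_iff_isLittleO_nhds_zero]
  rcases Nat.eq_zero_or_pos n with rfl | hn
  · have : (fun h : Rn 0 => f (p + h) - f p - inner ℝ a h) = fun _ => 0 := by
      funext h
      simp [Subsingleton.elim h 0]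
    rw [this]
    exact Asymptotics.isLittleO_zero _ _
  have hn' : (0 : ℝ) < n := by exact_mod_cast hn
  refine Asymptotics.IsLittleO.of_bound fun ε hε => ?_
  have hax : ∀ i, ∀ᶠ t : ℝ in 𝓝 0,
      |f (p + t • EuclideanSpace.single i (1 : ℝ)) - f p - t * a i| ≤ ε / n * |t| := fun i => by
    have := (hasDerivAt_iff_isLittleO_nhds_zero.1 (hpart i)).def (by positivity : 0 < ε / n)
    simpa using this
  have hco : ∀ i, Tendsto (fun h : Rn n => (n : ℝ) * h i) (𝓝 0) (𝓝 0) := fun i => by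
    have hc : Continuous fun h : Rn n => (n : ℝ) * h i := by fun_prop
    simpa using hc.tendsto 0
  filter_upwards [eventually_all.2 fun i => (hco i).eventually (hax i)] with h hh
  have hlow := hsup h
  have hsum : ∑ i, (1 / (n : ℝ)) • (p + ((n : ℝ) * h i) • EuclideanSpace.single i (1 : ℝ)) =
      p + h := by
    ext j
    simp [Finset.sum_add_distrib, Pi.single_apply]
    field_simp
  have hJ := hf.map_sum_le (t := Finset.univ) (w := fun _ : Fin n => 1 / (n : ℝ))
    (p := fun i => p + ((n : ℝ) * h i) • EuclideanSpace.single i (1 : ℝ))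
    (fun _ _ => by positivity) (by simp [hn'.ne']) (fun _ _ => Set.mem_univ _)
  rw [hsum] at hJ
  have hterm : ∀ i ∈ (Finset.univ : Finset (Fin n)),
      (1 / (n : ℝ)) • f (p + ((n : ℝ) * h i) • EuclideanSpace.single i (1 : ℝ)) ≤
        (1 / (n : ℝ)) * f p + (h i * a i + ε / n * ‖h‖) := by
    intro i _
    have h1 := (abs_le.1 (hh i)).2
    rw [abs_mul, abs_of_pos hn'] at h1
    have h2 : |h i| ≤ ‖h‖ := PiLp.norm_apply_le h i
    have h3 : f (p + ((n : ℝ) * h i) • EuclideanSpace.single i (1 : ℝ)) ≤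
        f p + n * (h i * a i + ε / n * ‖h‖) := by
      have h4 : ε / n * (n * |h i|) ≤ ε / n * (n * ‖h‖) := by gcongr
      linarith
    calc _ ≤ (1 / (n : ℝ)) * (f p + n * (h i * a i + ε / n * ‖h‖)) := by
          rw [smul_eq_mul]; gcongr
      _ = _ := by field_simp
  have hJ2 := hJ.trans (Finset.sum_le_sum hterm)
  rw [Finset.sum_add_distrib, Finset.sum_add_distrib] at hJ2
  have hin : ∑ i, h i * a i = inner ℝ a h := by
    rw [PiLp.inner_apply]
    rfl
  simp only [Finset.sum_const, Finset.card_univ, Fintype.card_fin, nsmul_eq_mul, hin] at hJ2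
  have e1 : (n : ℝ) * (1 / n * f p) = f p := by field_simp
  have e2 : (n : ℝ) * (ε / n * ‖h‖) = ε * ‖h‖ := by field_simp
  rw [e1, e2] at hJ2
  rw [Real.norm_of_nonneg (by linarith)]
  linarith

theorem AssumptionH1.hasGradientAt_effectiveHamiltonian (h1 : AssumptionH1 H) {p : Rn n}
    {μ : Measure (Tn n × Rn n)} (hμ : matherMeasures H p = {μ}) :
    HasGradientAt (effectiveHamiltonian H) (∫ z, z.2 ∂μ) p := by
  have hmem : μ ∈ matherMeasures H p := by rw [hμ]; exact Set.mem_singleton _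
  have hint : Integrable (fun z : Tn n × Rn n => z.2) μ :=
    (integrable_norm_iff continuous_snd.aestronglyMeasurable).1 hmem.1.integrable_norm
  have hin : ∀ ξ : Rn n, ∫ z, inner ℝ z.2 ξ ∂μ = inner ℝ (∫ z, z.2 ∂μ) ξ := fun ξ => by
    rw [real_inner_comm, ← integral_inner hint]
    simp only [real_inner_comm]
  refine h1.convexOn_effectiveHamiltonian.hasGradientAt_of_partial (fun y => ?_) fun i => ?_
  · have := h1.add_mul_integral_le hmem y 1
    rwa [hin, one_smul, one_mul] at this
  · set e : Rn n := EuclideanSpace.single i (1 : ℝ) with he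
    have hval : ∫ z, inner ℝ z.2 e ∂μ = (∫ z, z.2 ∂μ) i := by
      rw [hin, he, EuclideanSpace.inner_single_right]
      simp
    obtain ⟨d₁, hd₁, ⟨ν₁, hν₁, hνd₁⟩, -⟩ := h1.exists_rightDeriv_isGreatest p e
    obtain ⟨d₂, hd₂, ⟨ν₂, hν₂, hνd₂⟩, -⟩ := h1.exists_leftDeriv_isLeast p e
    rw [hμ, Set.mem_singleton_iff] at hν₁ hν₂
    subst hν₁
    subst hν₂
    simp only [hval] at hνd₁ hνd₂
    rw [← hνd₁] at hd₁
    rw [← hνd₂] at hd₂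
    rw [hasDerivAt_iff_tendsto_slope_zero, ← nhdsLT_sup_nhdsGT, tendsto_sup]
    constructor
    · refine hd₂.congr fun t => ?_
      simp [div_eq_inv_mul]
    · refine hd₁.congr fun t => ?_
      simp [div_eq_inv_mul]

end Derivative

theorem theorem2 (n : ℕ) (H : Tn n → Rn n → ℝ) (h1 : AssumptionH1 H) (h2 : AssumptionH2 H) :
    (∀ p : Rn n, ∃! c : ℝ, CellProblemSolvable H p c) ∧
    ∀ p : Rn n,
      (∀ ξ : Rn n, ∃ dplus dminus : ℝ,
        Tendsto (fun t : ℝ => (effectiveHamiltonian H (p + t • ξ) - effectiveHamiltonian H p) / t)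
          (𝓝[>] 0) (𝓝 dplus) ∧
        Tendsto (fun t : ℝ => (effectiveHamiltonian H (p + t • ξ) - effectiveHamiltonian H p) / t)
          (𝓝[<] 0) (𝓝 dminus) ∧
        IsGreatest ((fun μ : Measure (Tn n × Rn n) => ∫ z, inner ℝ z.2 ξ ∂μ) ''
          matherMeasures H p) dplus ∧
        IsLeast ((fun μ : Measure (Tn n × Rn n) => ∫ z, inner ℝ z.2 ξ ∂μ) ''
          matherMeasures H p) dminus) ∧
      ∀ μ : Measure (Tn n × Rn n), matherMeasures H p = {μ} →
        HasGradientAt (effectiveHamiltonian H) (∫ z, z.2 ∂μ) p := by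
  refine ⟨h1.existsUnique_cellProblemSolvable, fun p => ⟨fun ξ => ?_, fun μ hμ =>
    h1.hasGradientAt_effectiveHamiltonian hμ⟩⟩
  obtain ⟨dplus, hplus, hgreatest⟩ := h1.exists_rightDeriv_isGreatest p ξ
  obtain ⟨dminus, hminus, hleast⟩ := h1.exists_leftDeriv_isLeast p ξ
  exact ⟨dplus, dminus, hplus, hminus, hgreatest, hleast⟩
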